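/- Let $E$ be a Dedekind complete $\Phi$-algebra, that is, a Dedekind complete real vector lattice with an associative multiplication with unit making it an $f$-algebra: products of positive elements are positive, and $u\wedge v=0$, $w\ge 0$ imply $(uw)\wedge v=(wu)\wedge v=0$. *Definitions.* For a band $B\subseteq E$ let $P_B$ be its band projection. For $x,y\in E$ let $B_{x<y}$ be the largest band $B$ such that $P_B(y-x)$ is a weak order unit of $B$ (that is, a positive element of $B$ to which only $0\in B$ is disjoint), and write $P_{x<y}$ for the projection onto it. For $a\le b$ let $[a,b]=\{x\in E: a\le x\le b\}$. A function $f:[a,b]\to E$ is - *locally band preserving* if $P(x)=P(y)$ implies $P(f(x))=P(f(y))$ for all $x,y\in[a,b]$ and every band projection $P$; - *order continuous* if for every net $(x_\alpha)$ in $[a,b]$ that order converges to a point $c\in[a,b]$, the net $f(x_\alpha)$ order converges to $f(c)$; here $z_\alpha\to z$ in order means that there is a set $S\subseteq E$ with $\inf S=0$ such that for every $\varepsilon\in S$ there is $\alpha_0$ with $|z_\alpha-z|\le\varepsilon$ for all $\alpha\ge\alpha_0$; - *integrable on $[a,b]$* if it is order bounded and $\sup_Q\sum_{i=1}^n m_i(x_i-x_{i-1})=\inf_Q\sum_{i=1}^n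 M_i(x_i-x_{i-1})$, where $Q$ runs over all finite partitions $a=x_0\le x_1\le\dots\le x_n=b$ in $E$, $m_i=\inf f([x_{i-1},x_i])$ and $M_i=\sup f([x_{i-1},x_i])$; the common value is $\int_a^b f(z)\,dz$. For arbitrary (possibly incomparable) $x,y$, if $f$ is integrable on $[x\wedge y,x\vee y]$, put $$\int_x^y f(z)\,dz := P_{x<y}\Big(\int_{x\wedge y}^{x\vee y} f(z)\,dz\Big)-P_{y<x}\Big(\int_{x\wedge y}^{x\vee y} f(z)\,dz\Big).$$ **Theorem.** Let $a\le b$ in $E$ and let $f:[a,b]\to E$ be locally band preserving, order continuous and integrable on $[a,b]$. Then for all $x,y\in[a,b]$ the function $f$ is integrable on $[x\wedge y,x\vee y]$, and there exists $c\in[x\wedge y,x\vee y]$ such that $$(y-x)f(c)=\int_x^y f(z)\,dz.$$ -/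

import Mathlib

open Set

noncomputable section

namespace VL

universe u

/-! ### Vector lattices, `f`-algebras, bands -/

/-- The `f`-algebra axioms on a lattice-ordered algebra: products of positive elements are
positive, and multiplication by a positive element preserves disjointness.  With `Ring E`,
`Algebra ℝ E` and an ordered real vector lattice structure this says that `E` is a unital
`f`-algebra; commutativity is not part of the definition. -/
class IsFAlgebra (E : Type u) [Ring E] [Lattice E] : Prop where
  mul_nonneg : ∀ x y : E, 0 ≤ x → 0 ≤ y → 0 ≤ x * y
  mul_right_disjoint : ∀ x y z : E, x ⊓ y = 0 → 0 ≤ z → (x * z) ⊓ y = 0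
  mul_left_disjoint : ∀ x y z : E, x ⊓ y = 0 → 0 ≤ z → (z * x) ⊓ y = 0

section Bands

variable {E : Type u} [AddCommGroup E] [Module ℝ E]

/-- A band: a solid linear subspace that is closed under all suprema existing in `E`. -/
structure IsBand [Lattice E] (B : Submodule ℝ E) : Prop where
  solid : ∀ x ∈ B, ∀ y : E, |y| ≤ |x| → y ∈ B
  sup_mem : ∀ (S : Set E) (s : E), S ⊆ B → IsLUB S s → s ∈ B

/-- `u` is a weak order unit of (the vector lattice) `B`: it is a positive element of `B`, and
only `0` in `B` is disjoint from `u`. -/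
def IsWeakOrderUnit [Lattice E] (B : Submodule ℝ E) (u : E) : Prop :=
  u ∈ B ∧ 0 ≤ u ∧ ∀ w ∈ B, |w| ⊓ u = 0 → w = 0

/-- The band projection onto a band `B` of a Dedekind complete vector lattice:
`P z = sup {w ∈ B : 0 ≤ w ≤ z}` for `0 ≤ z`, and `P z = P z⁺ - P z⁻` in general.
See `bandProj_mem` and `sub_bandProj_disjoint` below. -/
def bandProj [ConditionallyCompleteLattice E] (B : Submodule ℝ E) (z : E) : E :=
  sSup {w : E | w ∈ B ∧ 0 ≤ w ∧ w ≤ z⁺} - sSup {w : E | w ∈ B ∧ 0 ≤ w ∧ w ≤ z⁻}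

/-- The band `B_{x < y}`: the largest band `B`, with band projection `P`, for which `P (y - x)` is
a weak order unit of `B`.  That a largest one exists is `isGreatest_bandLT` below. -/
def bandLT [ConditionallyCompleteLattice E] (x y : E) : Submodule ℝ E :=
  sSup {B : Submodule ℝ E | IsBand B ∧ IsWeakOrderUnit B (bandProj B (y - x))}

end Bands

section WellDefined

variable {E : Type u} [AddCommGroup E]

theorem abs_inf_eq_zero_of_le [Lattice E] [IsOrderedAddMonoid E] {x y v : E}
    (h : |x| ≤ |y|) (hy : |y| ⊓ |v| = 0) : |x| ⊓ |v| = 0 :=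
  le_antisymm ((inf_le_inf_right _ h).trans hy.le) (le_inf (abs_nonneg _) (abs_nonneg _))

theorem add_inf_le [Lattice E] [IsOrderedAddMonoid E] {p q v : E} (hp : 0 ≤ p) (hq : 0 ≤ q)
    (hv : 0 ≤ v) : (p + q) ⊓ v ≤ p ⊓ v + q ⊓ v := by
  rw [add_inf, inf_add, inf_add]
  refine le_inf (le_inf inf_le_left ?_) (le_inf ?_ ?_)
  · exact inf_le_right.trans (le_add_of_nonneg_right hq)
  · exact inf_le_right.trans (le_add_of_nonneg_left hp)
  · exact inf_le_right.trans (le_add_of_nonneg_right hv)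

theorem abs_inf_add [Lattice E] [IsOrderedAddMonoid E] {x y v : E}
    (hx : |x| ⊓ |v| = 0) (hy : |y| ⊓ |v| = 0) : |x + y| ⊓ |v| = 0 := by
  refine le_antisymm ?_ (le_inf (abs_nonneg _) (abs_nonneg _))
  calc |x + y| ⊓ |v| ≤ (|x| + |y|) ⊓ |v| := inf_le_inf_right _ (abs_add_le x y)
    _ ≤ |x| ⊓ |v| + |y| ⊓ |v| := add_inf_le (abs_nonneg _) (abs_nonneg _) (abs_nonneg _)
    _ = 0 := by rw [hx, hy, add_zero]

variable [Module ℝ E]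

theorem abs_smul_le_nsmul [Lattice E] [IsOrderedAddMonoid E] [PosSMulMono ℝ E] (c : ℝ) (x : E) :
    ∃ n : ℕ, |c • x| ≤ n • |x| := by
  obtain ⟨n, hn⟩ := exists_nat_ge |c|
  refine ⟨n, ?_⟩
  have key : ∀ z : E, z ≤ |x| → -z ≤ |x| → c • z ≤ n • |x| := by
    intro z hz hz'
    have h1 : c • z ≤ |c| • |x| := by
      rcases le_total 0 c with hc | hc
      · rw [abs_of_nonneg hc]; exact smul_le_smul_of_nonneg_left hz hc
      · rw [abs_of_nonpos hc, ← neg_smul_neg]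
        exact smul_le_smul_of_nonneg_left hz' (neg_nonneg.2 hc)
    have h2 : 0 ≤ ((n : ℝ) - |c|) • |x| := smul_nonneg (sub_nonneg.2 hn) (abs_nonneg x)
    rw [sub_smul, sub_nonneg, Nat.cast_smul_eq_nsmul] at h2
    exact h1.trans h2
  refine abs_le'.2 ⟨key x (le_abs_self x) (neg_le_abs x), ?_⟩
  rw [← smul_neg]
  exact key (-x) (neg_le_abs x) (by rw [neg_neg]; exact le_abs_self x)

/-- The disjoint complement of a set. -/
def disjointCompl [Lattice E] [IsOrderedAddMonoid E] [PosSMulMono ℝ E] (D : Set E) :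
    Submodule ℝ E where
  carrier := {w | ∀ v ∈ D, |w| ⊓ |v| = 0}
  zero_mem' := fun v _ => by simp
  add_mem' := fun ha hb v hv => abs_inf_add (ha v hv) (hb v hv)
  smul_mem' := fun c x hx v hv => by
    obtain ⟨n, hn⟩ := abs_smul_le_nsmul c x
    have h : ∀ n : ℕ, |n • x| ⊓ |v| = 0 ∧ |n • (|x|)| ⊓ |v| = 0 := by
      intro n
      induction n with
      | zero => simp
      | succ k ih =>
        rw [succ_nsmul, succ_nsmul]
        exact ⟨abs_inf_add ih.1 (hx v hv), abs_inf_add ih.2 (by rw [abs_abs]; exact hx v hv)⟩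
    exact abs_inf_eq_zero_of_le (hn.trans (le_abs_self _)) (h n).2

theorem isBand_disjointCompl [Lattice E] [IsOrderedAddMonoid E] [PosSMulMono ℝ E] (D : Set E) :
    IsBand (disjointCompl D) where
  solid := fun x hx y hy v hv => abs_inf_eq_zero_of_le hy (hx v hv)
  sup_mem := by
    intro S s hS hs v hv
    have hneg : |s⁻| ⊓ |v| = 0 := by
      rcases S.eq_empty_or_nonempty with rfl | ⟨w, hw⟩
      · have h0 : 0 ≤ s := by
          have := hs.2 (show s + s ∈ upperBounds ∅ by simp)
          simpa using this
        rw [negPart_eq_zero.2 h0]; simp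
      · refine abs_inf_eq_zero_of_le (y := w) ?_ (hS hw v hv)
        rw [abs_of_nonneg (negPart_nonneg s)]
        exact (negPart_anti (hs.1 hw)).trans (by
          rw [← posPart_add_negPart w]; exact le_add_of_nonneg_left (posPart_nonneg w))
    have hpos : |s⁺| ⊓ |v| = 0 := by
      rw [abs_of_nonneg (posPart_nonneg s)]
      set t := s⁺ ⊓ |v| with ht
      have ht0 : 0 ≤ t := le_inf (posPart_nonneg s) (abs_nonneg v)
      have hub : s - t ∈ upperBounds S := by
        intro w hw
        have h1 : w⁺ ⊓ t = 0 := by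
          refine le_antisymm ?_ (le_inf (posPart_nonneg w) ht0)
          have h2 := abs_inf_eq_zero_of_le (x := w⁺) (by
            rw [abs_of_nonneg (posPart_nonneg w), ← posPart_add_negPart w]
            exact le_add_of_nonneg_right (negPart_nonneg w)) (hS hw v hv)
          rw [abs_of_nonneg (posPart_nonneg w)] at h2
          exact (inf_le_inf_left _ inf_le_right).trans h2.le
        have h3 : w⁺ + t ≤ s⁺ := by
          rw [← inf_add_sup, h1, zero_add]
          exact sup_le (posPart_mono (hs.1 hw)) inf_le_left
        have h4 : s⁻ ≤ w⁻ := negPart_anti (hs.1 hw)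
        rw [le_sub_iff_add_le]
        calc w + t = (w⁺ + t) - w⁻ := by
              conv_lhs => rw [← posPart_sub_negPart w]
              abel
          _ ≤ s⁺ - s⁻ := sub_le_sub h3 h4
          _ = s := posPart_sub_negPart s
      have h5 : s ≤ s - t := hs.2 hub
      exact le_antisymm (by simpa using h5) ht0
    have := abs_inf_add hpos (y := -s⁻) (by rw [abs_neg]; exact hneg)
    rwa [← sub_eq_add_neg, posPart_sub_negPart] at this

variable [ConditionallyCompleteLattice E]

theorem sSup_le_of_nonneg (B : Submodule ℝ E) {z : E} (hz : 0 ≤ z) :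
    0 ≤ sSup {w : E | w ∈ B ∧ 0 ≤ w ∧ w ≤ z} ∧ sSup {w : E | w ∈ B ∧ 0 ≤ w ∧ w ≤ z} ≤ z :=
  ⟨le_csSup ⟨z, fun _ hw => hw.2.2⟩ ⟨B.zero_mem, le_rfl, hz⟩,
    csSup_le ⟨0, B.zero_mem, le_rfl, hz⟩ fun _ hw => hw.2.2⟩

theorem sSup_band_mem {B : Submodule ℝ E} (hB : IsBand B) {z : E} (hz : 0 ≤ z) :
    sSup {w : E | w ∈ B ∧ 0 ≤ w ∧ w ≤ z} ∈ B :=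
  hB.sup_mem _ _ (fun _ hw => hw.1)
    (isLUB_csSup ⟨0, B.zero_mem, le_rfl, hz⟩ ⟨z, fun _ hw => hw.2.2⟩)

/-- The projection onto a band takes its values in the band. -/
theorem bandProj_mem {B : Submodule ℝ E} (hB : IsBand B) (z : E) : bandProj B z ∈ B :=
  B.sub_mem (sSup_band_mem hB (posPart_nonneg z)) (sSup_band_mem hB (negPart_nonneg z))

variable [IsOrderedAddMonoid E]

theorem sub_sSup_band_disjoint {B : Submodule ℝ E} (hB : IsBand B) {z : E} (hz : 0 ≤ z)
    {v : E} (hv : v ∈ B) : |z - sSup {w : E | w ∈ B ∧ 0 ≤ w ∧ w ≤ z}| ⊓ |v| = 0 := by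
  obtain ⟨h0, h1⟩ := sSup_le_of_nonneg B hz
  have hlub := isLUB_csSup (s := {w : E | w ∈ B ∧ 0 ≤ w ∧ w ≤ z})
    ⟨0, B.zero_mem, le_rfl, hz⟩ ⟨z, fun _ hw => hw.2.2⟩
  set s := sSup {w : E | w ∈ B ∧ 0 ≤ w ∧ w ≤ z} with hs
  rw [abs_of_nonneg (sub_nonneg.2 h1)]
  set t := (z - s) ⊓ |v| with ht
  have ht0 : 0 ≤ t := le_inf (sub_nonneg.2 h1) (abs_nonneg v)
  have htB : t ∈ B := hB.solid v hv t (by rw [abs_of_nonneg ht0]; exact inf_le_right)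
  have h2 : s ≤ s - t := by
    refine hlub.2 fun w hw => ?_
    rw [le_sub_iff_add_le]
    refine hlub.1 ⟨B.add_mem hw.1 htB, add_nonneg hw.2.1 ht0, ?_⟩
    calc w + t ≤ s + (z - s) := add_le_add (hlub.1 hw) inf_le_left
      _ = z := by abel
  exact le_antisymm (by simpa using h2) ht0

/-- The complementary component is disjoint from the band. -/
theorem sub_bandProj_disjoint {B : Submodule ℝ E} (hB : IsBand B) (z : E) {v : E} (hv : v ∈ B) :
    |z - bandProj B z| ⊓ |v| = 0 := by
  have h := abs_inf_add (sub_sSup_band_disjoint hB (posPart_nonneg z) hv)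
    (y := -(z⁻ - sSup {w : E | w ∈ B ∧ 0 ≤ w ∧ w ≤ z⁻}))
    (by rw [abs_neg]; exact sub_sSup_band_disjoint hB (negPart_nonneg z) hv)
  convert h using 3
  unfold bandProj
  have e := posPart_sub_negPart z
  set p := sSup {w : E | w ∈ B ∧ 0 ≤ w ∧ w ≤ z⁺}
  set q := sSup {w : E | w ∈ B ∧ 0 ≤ w ∧ w ≤ z⁻}
  calc z - (p - q) = (z⁺ - z⁻) - (p - q) := by rw [e]
    _ = z⁺ - p + -(z⁻ - q) := by abel

/-- `bandLT x y` really is the largest band `B` for which the projection of `y - x` onto `B` is a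
weak order unit of `B`. -/
theorem isGreatest_bandLT [PosSMulMono ℝ E] (x y : E) :
    IsGreatest {B : Submodule ℝ E | IsBand B ∧ IsWeakOrderUnit B (bandProj B (y - x))}
      (bandLT x y) := by
  set z := y - x with hz
  set A : Set (Submodule ℝ E) := {B | IsBand B ∧ IsWeakOrderUnit B (bandProj B z)} with hA
  have h0 : 0 ≤ z⁺ := posPart_nonneg z
  suffices h : IsGreatest A (disjointCompl (disjointCompl {z⁺} : Set E)) by
    have e : bandLT x y = disjointCompl (disjointCompl {z⁺} : Set E) := h.isLUB.sSup_eq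
    rw [e]; exact h
  have hzB : z⁺ ∈ disjointCompl (disjointCompl {z⁺} : Set E) := fun v hv => by
    rw [inf_comm]; exact hv _ rfl
  have hzneg : z⁻ ∈ disjointCompl {z⁺} := by
    rintro v rfl
    rw [abs_of_nonneg (negPart_nonneg z), abs_of_nonneg h0, inf_comm]
    exact posPart_inf_negPart_eq_zero z
  have hproj : bandProj (disjointCompl (disjointCompl {z⁺} : Set E)) z = z⁺ := by
    have e1 : IsGreatest {w : E | w ∈ disjointCompl (disjointCompl {z⁺} : Set E) ∧ 0 ≤ w ∧ w ≤ z⁺}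
        z⁺ := ⟨⟨hzB, h0, le_rfl⟩, fun _ hw => hw.2.2⟩
    have e2 : IsGreatest {w : E | w ∈ disjointCompl (disjointCompl {z⁺} : Set E) ∧ 0 ≤ w ∧ w ≤ z⁻}
        0 := by
      refine ⟨⟨Submodule.zero_mem _, le_rfl, negPart_nonneg z⟩, fun w hw => ?_⟩
      have := hw.1 _ hzneg
      rw [abs_of_nonneg hw.2.1, abs_of_nonneg (negPart_nonneg z), inf_eq_left.2 hw.2.2] at this
      exact this.le
    rw [bandProj, e1.csSup_eq, e2.csSup_eq, sub_zero]
  refine ⟨⟨isBand_disjointCompl _, ?_⟩, ?_⟩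
  · rw [hproj]
    refine ⟨hzB, h0, fun w hw hwz => ?_⟩
    have hmem : w ∈ disjointCompl {z⁺} := by
      rintro v rfl
      rw [abs_of_nonneg h0]; exact hwz
    have := hw w hmem
    rw [inf_idem] at this
    exact le_antisymm ((le_abs_self w).trans this.le)
      (neg_nonpos.1 ((neg_le_abs w).trans this.le))
  · rintro B ⟨hB, _, he0, hunit⟩ w hw v hv
    have hle : bandProj B z ≤ z⁺ := by
      unfold bandProj
      exact (sub_le_self _ (sSup_le_of_nonneg B (negPart_nonneg z)).1).trans
        (sSup_le_of_nonneg B h0).2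
    have ht0 : 0 ≤ |w| ⊓ |v| := le_inf (abs_nonneg w) (abs_nonneg v)
    refine hunit _ (hB.solid w hw _ (by rw [abs_of_nonneg ht0]; exact inf_le_left)) ?_
    rw [abs_of_nonneg ht0]
    refine le_antisymm ?_ (le_inf ht0 he0)
    have := hv z⁺ rfl
    rw [abs_of_nonneg h0] at this
    exact (inf_le_inf inf_le_right hle).trans this.le

end WellDefined

/-! ### Order continuity and locally band preserving functions -/

/-- Order convergence of a net: there is a set `S` with infimum `0` such that for each `ε ∈ S`
eventually `|x i - c| ≤ ε`. -/
def OrderConverges {E : Type u} [AddCommGroup E] [Lattice E] {ι : Type u} [Preorder ι]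
    (x : ι → E) (c : E) : Prop :=
  ∃ S : Set E, IsGLB S 0 ∧ ∀ ε ∈ S, ∃ i₀ : ι, ∀ i, i₀ ≤ i → |x i - c| ≤ ε

/-- `f` is order continuous on `D`: if a net in `D` order converges to a point `c ∈ D`, then its
image order converges to `f c`.  (Nets indexed by directed sets in the universe of `E` are
enough.) -/
def OrderContinuousOn {E : Type u} [AddCommGroup E] [Lattice E] (f : E → E) (D : Set E) : Prop :=
  ∀ c ∈ D, ∀ (ι : Type u) [Preorder ι] [IsDirectedOrder ι] [Nonempty ι] (x : ι → E),
    (∀ i, x i ∈ D) → OrderConverges x c → OrderConverges (fun i => f (x i)) (f c)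

/-- `f` is locally band preserving on `D`: for every band projection `P` and all `x, y ∈ D`,
`P x = P y` implies `P (f x) = P (f y)`. -/
def LocallyBandPreservingOn {E : Type u} [AddCommGroup E] [Module ℝ E]
    [ConditionallyCompleteLattice E] (f : E → E) (D : Set E) : Prop :=
  ∀ B : Submodule ℝ E, IsBand B → ∀ x ∈ D, ∀ y ∈ D,
    bandProj B x = bandProj B y → bandProj B (f x) = bandProj B (f y)

/-! ### The Darboux integral -/

/-- A partition `a = x 0 ≤ x 1 ≤ ⋯ ≤ x n = b` of the order interval `[a, b]`
(the values `x i` for `i > n` play no role). -/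
structure IntervalPartition {E : Type u} [Lattice E] (a b : E) where
  n : ℕ
  x : ℕ → E
  le_succ : ∀ i < n, x i ≤ x (i + 1)
  left : x 0 = a
  right : x n = b

section Darboux

variable {E : Type u} [Ring E] [ConditionallyCompleteLattice E]

/-- The lower sum `∑ m_i (x_i - x_{i-1})`, where `m_i` is the infimum of `f` on
`[x_{i-1}, x_i]`. -/
def lowerSum (f : E → E) {a b : E} (P : IntervalPartition a b) : E :=
  ∑ i ∈ Finset.range P.n, sInf (f '' Icc (P.x i) (P.x (i + 1))) * (P.x (i + 1) - P.x i)

/-- The upper sum `∑ M_i (x_i - x_{i-1})`, where `M_i` is the supremum of `f` on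
`[x_{i-1}, x_i]`. -/
def upperSum (f : E → E) {a b : E} (P : IntervalPartition a b) : E :=
  ∑ i ∈ Finset.range P.n, sSup (f '' Icc (P.x i) (P.x (i + 1))) * (P.x (i + 1) - P.x i)

/-- The lower integral of `f` over `[a, b]`. -/
def lowerIntegral (f : E → E) (a b : E) : E :=
  sSup (range fun P : IntervalPartition a b => lowerSum f P)

/-- The upper integral of `f` over `[a, b]`. -/
def upperIntegral (f : E → E) (a b : E) : E :=
  sInf (range fun P : IntervalPartition a b => upperSum f P)

/-- `f` is (Darboux) integrable on `[a, b]`: it is order bounded on `[a, b]`, and its upper and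
lower integrals coincide. -/
def DarbouxIntegrableOn (f : E → E) (a b : E) : Prop :=
  (BddBelow (f '' Icc a b) ∧ BddAbove (f '' Icc a b)) ∧ upperIntegral f a b = lowerIntegral f a b

/-- The (Darboux) integral of `f` over `[a, b]`, for `a ≤ b` and `f` integrable on `[a, b]`. -/
def darbouxIntegral (f : E → E) (a b : E) : E :=
  upperIntegral f a b

/-- The integral of `f` from `x` to `y`, for arbitrary (possibly incomparable) `x` and `y` such
that `f` is integrable on `[x ⊓ y, x ⊔ y]`. -/
def integralFromTo [Module ℝ E] (f : E → E) (x y : E) : E :=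
  bandProj (bandLT x y) (darbouxIntegral f (x ⊓ y) (x ⊔ y)) -
    bandProj (bandLT y x) (darbouxIntegral f (x ⊓ y) (x ⊔ y))

end Darboux

end VL

end

/-!
A Dedekind complete unital `f`-algebra behaves like an algebra of real functions, and the scalar
proof of the mean value theorem is carried out "at all points at once". Statements that would be
made pointwise are expressed by components of the unit: a band projection is multiplication by the
idempotent `bandProj B 1` (`bandProj_eq_mul`), every `v` has such an idempotent as carrier
(`exists_band_carrier`), and a locally band preserving `f` commutes with gluing along it
(`LocallyBandPreservingOn.apply_glue`). The algebra is commutative (`mul_comm_of_isFAlgebra`), and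
its multiplication is order continuous (`nonpos_of_forall_le_mul`).

*Integrability on subintervals.* Two partitions are chains whose points need not be comparable, so
there is no common refinement. It is replaced by the positive elements `overlap s t u v`, the
lengths of intersections of intervals: they sum to the length of either interval
(`IntervalPartition.sum_overlap`), and where an overlap does not vanish the two intervals share a
point (`sub_clamp_disjoint`), which local band preservation turns into inequalities between the
values of `f`. Hence lower sums lie below upper sums (`lowerSum_le_upperSum`), and truncating two
partitions to a subinterval does not increase the difference of the sums
(`upperSum_clamp_sub_lowerSum_clamp_le`).

*The mean value.* Let `p = x ⊓ y`, `q = x ⊔ y` and `I` the integral over `[p, q]`. The function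
`F z = f z * (q - p) - I` has infimum at most `0` and supremum at least `0` on `[p, q]`. Bisection,
with the half chosen separately on complementary bands, keeps both inequalities
(`Straddles.bisect`); the nested intervals shrink to a point `c`, and order continuity gives
`F c = 0` (`exists_eq_zero_of_straddles`). Finally the projections onto `bandLT x y` and
`bandLT y x` take `q - p = |y - x|` to the positive and negative parts of `y - x`
(`bandProj_bandLT_mul_abs`).
-/

namespace VL

universe u

/-! ### Order properties of the multiplication of an `f`-algebra -/

section LatticeGroup

variable {E : Type u} [AddCommGroup E] [Lattice E] [IsOrderedAddMonoid E]

theorem sub_inf_eq_posPart (x y : E) : x - x ⊓ y = (x - y)⁺ := by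
  rw [inf_eq_sub_posPart_sub]; abel

theorem sup_sub_eq_posPart (x y : E) : x ⊔ y - y = (x - y)⁺ := by
  rw [sup_eq_add_posPart_sub]; abel

theorem posPart_sub_inf_posPart_sub (x y : E) : (x - y)⁺ ⊓ (y - x)⁺ = 0 := by
  rw [← neg_sub x y, posPart_neg]; exact posPart_inf_negPart_eq_zero _

theorem abs_inf_abs_eq_zero_of_le {x y v w : E} (h : |x| ≤ y) (h' : |v| ≤ w)
    (hy : y ⊓ w = 0) : |x| ⊓ |v| = 0 :=
  le_antisymm ((inf_le_inf h h').trans hy.le) (le_inf (abs_nonneg _) (abs_nonneg _))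

end LatticeGroup

section Ring

variable {E : Type u} [Ring E] [Lattice E] [IsOrderedAddMonoid E] [IsFAlgebra E]

/-- Disjoint positive elements of an `f`-algebra have product zero: multiplying `x ⊓ y = 0` by `x`
on one side and by `y` on the other gives `x * y ⊓ x * y = 0`. -/
theorem mul_eq_zero_of_inf_eq_zero {E : Type u} [Ring E] [Lattice E] [IsFAlgebra E] {x y : E}
    (h : x ⊓ y = 0) : x * y = 0 := by
  have hx : 0 ≤ x := h ▸ inf_le_left
  have hy : 0 ≤ y := h ▸ inf_le_right
  have h1 := IsFAlgebra.mul_right_disjoint x y y h hy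
  have h2 := IsFAlgebra.mul_left_disjoint y (x * y) x (by rw [inf_comm]; exact h1) hx
  rwa [inf_idem] at h2

theorem mul_eq_zero_of_disjoint {x y : E} (h : |x| ⊓ |y| = 0) : x * y = 0 := by
  have key : ∀ p q : E, 0 ≤ p → 0 ≤ q → p ≤ |x| → q ≤ |y| → p * q = 0 := fun p q hp hq hpx hqy =>
    mul_eq_zero_of_inf_eq_zero (le_antisymm ((inf_le_inf hpx hqy).trans h.le) (le_inf hp hq))
  have e : ∀ z : E, z⁺ ≤ |z| ∧ z⁻ ≤ |z| := fun z => by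
    rw [← posPart_add_negPart z]
    exact ⟨le_add_of_nonneg_right (negPart_nonneg z), le_add_of_nonneg_left (posPart_nonneg z)⟩
  rw [← posPart_sub_negPart x, ← posPart_sub_negPart y, sub_mul, mul_sub, mul_sub,
    key _ _ (posPart_nonneg x) (posPart_nonneg y) (e x).1 (e y).1,
    key _ _ (posPart_nonneg x) (negPart_nonneg y) (e x).1 (e y).2,
    key _ _ (negPart_nonneg x) (posPart_nonneg y) (e x).2 (e y).1,
    key _ _ (negPart_nonneg x) (negPart_nonneg y) (e x).2 (e y).2]
  simp

theorem posPart_mul_negPart (x : E) : x⁺ * x⁻ = 0 :=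
  mul_eq_zero_of_inf_eq_zero (posPart_inf_negPart_eq_zero x)

theorem negPart_mul_posPart (x : E) : x⁻ * x⁺ = 0 :=
  mul_eq_zero_of_inf_eq_zero (by rw [inf_comm]; exact posPart_inf_negPart_eq_zero x)

theorem posPart_mul_self (x : E) : x⁺ * x = x⁺ * x⁺ := by
  conv_lhs => rw [← posPart_sub_negPart x, mul_sub]
  rw [posPart_sub_negPart, posPart_mul_negPart, sub_zero]

theorem zero_le_one_of_isFAlgebra : (0 : E) ≤ 1 := by
  -- `1 = 1 * 1`, and a square is the sum of the squares of the positive and negative parts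
  have h : (1 : E) = 1⁺ * 1⁺ + 1⁻ * 1⁻ := by
    calc (1 : E) = (1⁺ - 1⁻) * (1⁺ - 1⁻) := by rw [posPart_sub_negPart, one_mul]
      _ = _ := by
        rw [sub_mul, mul_sub, mul_sub, posPart_mul_negPart, negPart_mul_posPart]; simp
  rw [h]
  exact add_nonneg (IsFAlgebra.mul_nonneg _ _ (posPart_nonneg _) (posPart_nonneg _))
    (IsFAlgebra.mul_nonneg _ _ (negPart_nonneg _) (negPart_nonneg _))

instance isOrderedRing_of_isFAlgebra : IsOrderedRing E :=
  haveI : ZeroLEOneClass E := ⟨zero_le_one_of_isFAlgebra⟩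
  IsOrderedRing.of_mul_nonneg IsFAlgebra.mul_nonneg

/-- Multiplication by a positive element is a lattice homomorphism. -/
theorem inf_mul_of_nonneg (x y : E) {d : E} (hd : 0 ≤ d) : (x ⊓ y) * d = x * d ⊓ y * d := by
  have h0 : (x - x ⊓ y) ⊓ (y - x ⊓ y) = 0 := by
    rw [sub_inf_eq_posPart, inf_comm x y, sub_inf_eq_posPart]
    exact posPart_sub_inf_posPart_sub x y
  have h1 := IsFAlgebra.mul_right_disjoint _ _ d h0 hd
  have h2 := IsFAlgebra.mul_right_disjoint _ _ d (by rw [inf_comm]; exact h1) hd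
  have h3 : x * d ⊓ y * d = (x * d - (x ⊓ y) * d) ⊓ (y * d - (x ⊓ y) * d) + (x ⊓ y) * d := by
    rw [inf_add]; simp
  rw [h3, ← sub_mul, ← sub_mul, inf_comm (_ * d), h2, zero_add]

/-- The part of a positive element above a large integer is relatively uniformly small. -/
theorem mul_posPart_sub_natCast_le {d : E} (hd : 0 ≤ d) (k : ℕ) :
    (k : E) * (d - k)⁺ ≤ d * d := by
  have hk : (0 : E) ≤ k := Nat.cast_nonneg k
  have hp := posPart_nonneg (d - (k : E))
  have h1 : (d - (k : E))⁺ ≤ d := by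
    rw [posPart_def]; exact sup_le (sub_le_self _ hk) hd
  have h2 : 0 ≤ (d - (k : E))⁺ * (d - k) := by rw [posPart_mul_self]; exact mul_nonneg hp hp
  rw [mul_sub, sub_nonneg, ← (Nat.cast_commute k _).eq] at h2
  exact h2.trans (mul_le_mul_of_nonneg_right h1 hd)

end Ring

section Archimedean

variable {E : Type u} [AddCommGroup E] [ConditionallyCompleteLattice E] [IsOrderedAddMonoid E]

theorem nonpos_of_nsmul_le {x y : E} (h : ∀ n : ℕ, n • x ≤ y) : x ≤ 0 := by
  have hlub := isLUB_csSup (s := range fun n : ℕ => n • x) (range_nonempty _)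
    ⟨y, by rintro _ ⟨n, rfl⟩; exact h n⟩
  set s := sSup (range fun n : ℕ => n • x)
  have h1 : s ≤ s - x := hlub.2 (by
    rintro _ ⟨n, rfl⟩
    rw [le_sub_iff_add_le]
    exact hlub.1 ⟨n + 1, succ_nsmul x n⟩)
  simpa using h1

variable [Module ℝ E] [PosSMulMono ℝ E]

theorem isGLB_range_pow_smul {d : E} (hd : 0 ≤ d) :
    IsGLB (range fun n : ℕ => (1 / 2 : ℝ) ^ n • d) 0 := by
  refine ⟨?_, fun w hw => ?_⟩
  · rintro _ ⟨n, rfl⟩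
    exact smul_nonneg (by positivity) hd
  -- a lower bound need not be positive, so the estimate is carried out for its positive part
  · have h3 : ∀ n : ℕ, n • w⁺ ≤ d := fun n => by
      have hp : ((1 / 2 : ℝ) ^ n) • d ∈ upperBounds {w, 0} := by
        rintro _ (rfl | rfl)
        · exact hw ⟨n, rfl⟩
        · exact smul_nonneg (by positivity) hd
      have hle : w⁺ ≤ (1 / 2 : ℝ) ^ n • d := sup_le (hp (by simp)) (hp (by simp))
      have := smul_le_smul_of_nonneg_left hle (show (0 : ℝ) ≤ 2 ^ n by positivity)
      rw [smul_smul, ← mul_pow] at this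
      have h4 : (2 ^ n : ℕ) • w⁺ ≤ d := by
        rw [← Nat.cast_smul_eq_nsmul ℝ]
        push_cast
        simpa using this
      exact (nsmul_le_nsmul_left (posPart_nonneg w) Nat.lt_two_pow_self.le).trans h4
    exact (le_posPart w).trans (nonpos_of_nsmul_le h3)

end Archimedean

/-! ### Band projections as multiplications, and commutativity -/

section Components

variable {E : Type u} [Ring E] [Algebra ℝ E] [ConditionallyCompleteLattice E]
  [IsOrderedAddMonoid E] [IsFAlgebra E]

/-- A band projection is multiplication by the component `bandProj B 1` of the unit. -/
theorem bandProj_eq_mul {B : Submodule ℝ E} (hB : IsBand B) (z : E) :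
    bandProj B z = bandProj B 1 * z := by
  have h1 := mul_eq_zero_of_disjoint (sub_bandProj_disjoint hB 1 (bandProj_mem hB z))
  have h2 := mul_eq_zero_of_disjoint
    ((inf_comm _ _).trans (sub_bandProj_disjoint hB z (bandProj_mem hB 1)))
  rw [sub_mul, one_mul, sub_eq_zero] at h1
  rw [mul_sub, sub_eq_zero] at h2
  rw [h1, h2]

theorem bandProj_eq_mul' {B : Submodule ℝ E} (hB : IsBand B) (z : E) :
    bandProj B z = z * bandProj B 1 := by
  have h1 := mul_eq_zero_of_disjoint
    ((inf_comm _ _).trans (sub_bandProj_disjoint hB 1 (bandProj_mem hB z)))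
  have h2 := mul_eq_zero_of_disjoint (sub_bandProj_disjoint hB z (bandProj_mem hB 1))
  rw [mul_sub, mul_one, sub_eq_zero] at h1
  rw [sub_mul, sub_eq_zero] at h2
  rw [h1, h2]

theorem bandProj_one_nonneg (B : Submodule ℝ E) : 0 ≤ bandProj B (1 : E) := by
  have h : (1 : E)⁻ = 0 := negPart_eq_zero.2 zero_le_one
  rw [bandProj, h, (show IsGreatest {w : E | w ∈ B ∧ 0 ≤ w ∧ w ≤ 0} 0 from
    ⟨⟨B.zero_mem, le_rfl, le_rfl⟩, fun _ hw => hw.2.2⟩).csSup_eq, sub_zero]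
  exact (sSup_le_of_nonneg B (posPart_nonneg 1)).1

theorem bandProj_one_le (B : Submodule ℝ E) : bandProj B (1 : E) ≤ 1 := by
  refine (sub_le_self _ (sSup_le_of_nonneg B (negPart_nonneg 1)).1).trans
    ((sSup_le_of_nonneg B (posPart_nonneg 1)).2.trans ?_)
  rw [posPart_eq_self.2 zero_le_one]

theorem bandProj_one_mul_self {B : Submodule ℝ E} (hB : IsBand B) :
    bandProj B (1 : E) * bandProj B 1 = bandProj B 1 := by
  have h := mul_eq_zero_of_disjoint (sub_bandProj_disjoint hB 1 (bandProj_mem hB 1))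
  rw [sub_mul, one_mul, sub_eq_zero] at h
  exact h.symm

theorem bandProj_one_mul_of_mem {B : Submodule ℝ E} (hB : IsBand B) {v : E} (hv : v ∈ B) :
    bandProj B 1 * v = v := by
  have h := mul_eq_zero_of_disjoint (sub_bandProj_disjoint hB 1 hv)
  rw [sub_mul, one_mul, sub_eq_zero] at h
  exact h.symm

variable [PosSMulMono ℝ E]

/-- The component of the unit carried by `v`: it acts as the identity on `v` and annihilates
everything disjoint from `v`. -/
theorem exists_band_carrier (v : E) : ∃ B : Submodule ℝ E, IsBand B ∧ bandProj B 1 * v = v ∧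
    ∀ w : E, |w| ⊓ |v| = 0 → bandProj B 1 * w = 0 := by
  have hB := isBand_disjointCompl (disjointCompl {v} : Set E)
  refine ⟨_, hB, bandProj_one_mul_of_mem hB fun w hw => ?_, fun w hw => ?_⟩
  · rw [inf_comm]; exact hw v rfl
  · exact mul_eq_zero_of_disjoint (bandProj_mem hB 1 w (by rintro _ rfl; exact hw))

/-- The commutator of `x` with an element between `0` and `1` is at most `x`. It stays so under
doubling: write `2 z = e + z'` with `e` the component of the unit on which `2 z > 1`, so that
`0 ≤ z' ≤ 1`; as `e` is central, the commutator with `z'` is twice that with `z`. -/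
theorem nsmul_commutator_le {x : E} (hx : 0 ≤ x) (n : ℕ) : ∀ z : E, 0 ≤ z → z ≤ 1 →
    (2 ^ n) • (x * z - z * x) ≤ x ∧ (2 ^ n) • (z * x - x * z) ≤ x := by
  induction n with
  | zero =>
    intro z hz hz1
    simp only [pow_zero, one_smul]
    constructor
    · refine (sub_le_self _ (mul_nonneg hz hx)).trans ?_
      simpa using mul_le_mul_of_nonneg_left hz1 hx
    · refine (sub_le_self _ (mul_nonneg hx hz)).trans ?_
      simpa using mul_le_mul_of_nonneg_right hz1 hx
  | succ n ih =>
    intro z hz hz1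
    obtain ⟨B, hB, he1, he2⟩ := exists_band_carrier ((2 * z - 1)⁺ : E)
    have hcomm : x * bandProj B 1 = bandProj B 1 * x := by
      rw [← bandProj_eq_mul hB x, bandProj_eq_mul' hB x]
    have h0 := bandProj_one_nonneg B
    have h1 := bandProj_one_le B
    have hn : bandProj B 1 * (2 * z - 1)⁻ = 0 := he2 _ (by
      rw [abs_of_nonneg (negPart_nonneg _), abs_of_nonneg (posPart_nonneg _), inf_comm]
      exact posPart_inf_negPart_eq_zero _)
    have hee := bandProj_one_mul_self hB
    set e := bandProj B (1 : E)
    have hE : e * (2 * z - 1) = (2 * z - 1)⁺ := by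
      conv_lhs => rw [← posPart_sub_negPart (2 * z - 1), mul_sub, he1, hn, sub_zero]
    have hz2 : (0 : E) ≤ 2 * z := mul_nonneg zero_le_two hz
    have e1 : 2 * z - e = e * (2 * z - 1) + (1 - e) * (2 * z) := by noncomm_ring
    have e2 : 1 - (2 * z - e) = 2 * (e * (1 - z)) + (2 * z - 1)⁻ := by
      have : (2 * z - 1)⁻ = e * (2 * z - 1) - (2 * z - 1) := by
        rw [hE, eq_sub_iff_add_eq']
        exact sub_eq_iff_eq_add.1 (posPart_sub_negPart _) |>.symm
      rw [this]; noncomm_ring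
    have hlow : 0 ≤ 2 * z - e := by
      rw [e1, hE]
      exact add_nonneg (posPart_nonneg _) (mul_nonneg (sub_nonneg.2 h1) hz2)
    have hup : 2 * z - e ≤ 1 := by
      rw [← sub_nonneg, e2]
      exact add_nonneg (mul_nonneg zero_le_two (mul_nonneg h0 (sub_nonneg.2 hz1)))
        (negPart_nonneg _)
    obtain ⟨i1, i2⟩ := ih _ hlow hup
    have c1 : x * (2 * z - e) - (2 * z - e) * x = 2 • (x * z - z * x) := by
      rw [mul_sub, sub_mul, hcomm]; noncomm_ring
    have c2 : (2 * z - e) * x - x * (2 * z - e) = 2 • (z * x - x * z) := by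
      rw [mul_sub, sub_mul, hcomm]; noncomm_ring
    rw [c1, smul_smul, ← pow_succ] at i1
    rw [c2, smul_smul, ← pow_succ] at i2
    exact ⟨i1, i2⟩

theorem mul_comm_of_nonneg_of_le_one {x z : E} (hx : 0 ≤ x) (hz : 0 ≤ z) (hz1 : z ≤ 1) :
    x * z = z * x := by
  have key : ∀ w : E, (∀ n : ℕ, (2 ^ n) • w ≤ x) → w ≤ 0 := fun w hw => by
    refine (isGLB_range_pow_smul hx).2 ?_
    · rintro _ ⟨n, rfl⟩
      have := smul_le_smul_of_nonneg_left (hw n) (show (0 : ℝ) ≤ (1 / 2) ^ n by positivity)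
      rw [← Nat.cast_smul_eq_nsmul ℝ, smul_smul] at this
      push_cast at this
      rw [← mul_pow] at this
      simpa using this
  exact le_antisymm (sub_nonpos.1 (key _ fun n => (nsmul_commutator_le hx n z hz hz1).1))
    (sub_nonpos.1 (key _ fun n => (nsmul_commutator_le hx n z hz hz1).2))

theorem mul_comm_of_nonneg {x z : E} (hx : 0 ≤ x) (hz : 0 ≤ z) : x * z = z * x := by
  -- split `z = z ⊓ k + (z - k)⁺`: the first summand is `k` times a central element
  have hsplit : ∀ k : ℕ, (x * z - z * x) = x * (z - k)⁺ - (z - k)⁺ * x := fun k => by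
    have hk : x * (z ⊓ (k : E)) = (z ⊓ (k : E)) * x := by
      rcases Nat.eq_zero_or_pos k with rfl | hkpos
      · simp [inf_eq_right.2 hz]
      · have hk0 : (0 : ℝ) < k := Nat.cast_pos.2 hkpos
        have hinf : 0 ≤ z ⊓ (k : E) := le_inf hz (Nat.cast_nonneg k)
        have h := mul_comm_of_nonneg_of_le_one hx
          (z := (k : ℝ)⁻¹ • (z ⊓ (k : E))) (smul_nonneg (inv_nonneg.2 hk0.le) hinf) (by
            have := smul_le_smul_of_nonneg_left (inf_le_right : z ⊓ (k : E) ≤ k)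
              (inv_nonneg.2 hk0.le)
            refine this.trans_eq ?_
            rw [show (k : E) = (k : ℝ) • (1 : E) by rw [Nat.cast_smul_eq_nsmul, nsmul_one], smul_smul,
              inv_mul_cancel₀ hk0.ne', one_smul])
        rw [mul_smul_comm, smul_mul_assoc] at h
        exact smul_right_injective E (inv_ne_zero hk0.ne') h
    have hz' : z = z ⊓ (k : E) + (z - k)⁺ := by rw [← sub_inf_eq_posPart]; abel
    conv_lhs => rw [hz', mul_add, add_mul, hk]
    abel
  have hb : ∀ k : ℕ, k • (x * z - z * x) ≤ x * (z * z) ∧ k • (z * x - x * z) ≤ (z * z) * x := by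
    intro k
    have hp := posPart_nonneg (z - (k : E))
    have hle := mul_posPart_sub_natCast_le hz k
    constructor
    · rw [hsplit k, nsmul_eq_mul]
      calc (k : E) * (x * (z - k)⁺ - (z - k)⁺ * x) ≤ k * (x * (z - k)⁺) :=
            mul_le_mul_of_nonneg_left (sub_le_self _ (mul_nonneg hp hx)) (Nat.cast_nonneg k)
        _ = x * (k * (z - k)⁺) := by rw [← mul_assoc, (Nat.cast_commute k x).eq, mul_assoc]
        _ ≤ _ := mul_le_mul_of_nonneg_left hle hx
    · rw [← neg_sub, hsplit k, neg_sub, nsmul_eq_mul]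
      calc (k : E) * ((z - k)⁺ * x - x * (z - k)⁺) ≤ k * ((z - k)⁺ * x) :=
            mul_le_mul_of_nonneg_left (sub_le_self _ (mul_nonneg hx hp)) (Nat.cast_nonneg k)
        _ = (k * (z - k)⁺) * x := by rw [mul_assoc]
        _ ≤ _ := mul_le_mul_of_nonneg_right hle hx
  exact le_antisymm (sub_nonpos.1 (nonpos_of_nsmul_le fun k => (hb k).1))
    (sub_nonpos.1 (nonpos_of_nsmul_le fun k => (hb k).2))

/-- A Dedekind complete unital `f`-algebra is commutative. -/
theorem mul_comm_of_isFAlgebra (x z : E) : x * z = z * x := by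
  rw [← posPart_sub_negPart x, ← posPart_sub_negPart z]
  simp only [sub_mul, mul_sub]
  rw [mul_comm_of_nonneg (posPart_nonneg x) (posPart_nonneg z),
    mul_comm_of_nonneg (posPart_nonneg x) (negPart_nonneg z),
    mul_comm_of_nonneg (negPart_nonneg x) (posPart_nonneg z),
    mul_comm_of_nonneg (negPart_nonneg x) (negPart_nonneg z)]
  abel

/-- Order continuity of the multiplication. -/
theorem nonpos_of_forall_le_mul {S : Set E} (hS : IsGLB S 0) {d w : E} (hd : 0 ≤ d)
    (hw : ∀ s ∈ S, w ≤ s * d) : w ≤ 0 := by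
  rcases S.eq_empty_or_nonempty with rfl | ⟨s₀, hs₀⟩
  · exact hS.2 (by simp)
  have h0 : 0 ≤ s₀ := hS.1 hs₀
  -- `w ≤ (s ⊓ s₀) * d ≤ k * s + s₀ * (d - k)⁺` for all `s ∈ S`
  have h1 : ∀ k : ℕ, 0 < k → w ≤ s₀ * (d - k)⁺ := fun k hk => by
    have hk0 : (0 : ℝ) < k := Nat.cast_pos.2 hk
    rw [← sub_nonpos]
    have h2 : ∀ s ∈ S, w - s₀ * (d - k)⁺ ≤ (k : ℝ) • s := fun s hs => by
      have hi : 0 ≤ s ⊓ s₀ := le_inf (hS.1 hs) h0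
      rw [sub_le_iff_le_add]
      calc w ≤ (s ⊓ s₀) * d := by rw [inf_mul_of_nonneg _ _ hd]; exact le_inf (hw s hs) (hw s₀ hs₀)
        _ ≤ (s ⊓ s₀) * (k + (d - k)⁺) := mul_le_mul_of_nonneg_left (by
            rw [← sub_le_iff_le_add']; exact le_posPart _) hi
        _ = (s ⊓ s₀) * k + (s ⊓ s₀) * (d - k)⁺ := mul_add _ _ _
        _ ≤ s * k + s₀ * (d - k)⁺ := add_le_add
            (mul_le_mul_of_nonneg_right inf_le_left (Nat.cast_nonneg k))
            (mul_le_mul_of_nonneg_right inf_le_right (posPart_nonneg _))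
        _ = _ := by rw [Nat.cast_smul_eq_nsmul, nsmul_eq_mul, (Nat.cast_commute k s).eq]
    have h3 : (k : ℝ)⁻¹ • (w - s₀ * (d - k)⁺) ≤ 0 := hS.2 fun s hs => by
      have := smul_le_smul_of_nonneg_left (h2 s hs) (inv_nonneg.2 hk0.le)
      rwa [smul_smul, inv_mul_cancel₀ hk0.ne', one_smul] at this
    have h4 := smul_le_smul_of_nonneg_left h3 hk0.le
    rwa [smul_smul, mul_inv_cancel₀ hk0.ne', one_smul, smul_zero] at h4
  refine nonpos_of_nsmul_le (y := s₀ * (d * d)) fun k => ?_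
  rcases Nat.eq_zero_or_pos k with rfl | hk
  · rw [zero_smul]; exact mul_nonneg h0 (mul_nonneg hd hd)
  · calc k • w ≤ k • (s₀ * (d - k)⁺) := nsmul_le_nsmul_right (h1 k hk) k
      _ = s₀ * (k * (d - k)⁺) := by
        rw [nsmul_eq_mul, ← mul_assoc, (Nat.cast_commute k s₀).eq, mul_assoc]
      _ ≤ _ := mul_le_mul_of_nonneg_left (mul_posPart_sub_natCast_le hd k) h0

theorem csSup_mul_le {S : Set E} (hne : S.Nonempty) (hb : BddAbove S) {d t : E} (hd : 0 ≤ d)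
    (h : ∀ s ∈ S, s * d ≤ t) : sSup S * d ≤ t := by
  have hlub := isLUB_csSup hne hb
  have hglb : IsGLB ((fun s => sSup S - s) '' S) 0 := by
    refine ⟨?_, fun w hw => ?_⟩
    · rintro _ ⟨s, hs, rfl⟩
      exact sub_nonneg.2 (hlub.1 hs)
    · have : sSup S ≤ sSup S - w := hlub.2 fun s hs => le_sub_comm.1 (hw ⟨s, hs, rfl⟩)
      simpa using this
  rw [← sub_nonpos]
  refine nonpos_of_forall_le_mul hglb hd ?_
  rintro _ ⟨s, hs, rfl⟩
  rw [sub_mul]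
  exact sub_le_sub_left (h s hs) _

theorem le_csInf_mul {S : Set E} (hne : S.Nonempty) (hb : BddBelow S) {d t : E} (hd : 0 ≤ d)
    (h : ∀ s ∈ S, t ≤ s * d) : t ≤ sInf S * d := by
  have hglb := isGLB_csInf hne hb
  have hglb' : IsGLB ((fun s => s - sInf S) '' S) 0 := by
    refine ⟨?_, fun w hw => ?_⟩
    · rintro _ ⟨s, hs, rfl⟩
      exact sub_nonneg.2 (hglb.1 hs)
    · have : w + sInf S ≤ sInf S := hglb.2 fun s hs => le_sub_iff_add_le.1 (hw ⟨s, hs, rfl⟩)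
      simpa using this
  rw [← sub_nonpos]
  refine nonpos_of_forall_le_mul hglb' hd ?_
  rintro _ ⟨s, hs, rfl⟩
  rw [sub_mul]
  exact sub_le_sub_right (h s hs) _

end Components

/-! ### An intermediate value theorem by bisection -/

theorem negPart_inf_eq_zero_of_nonneg_sup {E : Type u} [AddCommGroup E] [Lattice E]
    [IsOrderedAddMonoid E] {x y : E} (h : 0 ≤ x ⊔ y) : x⁻ ⊓ y⁻ = 0 := by
  refine le_antisymm ?_ (le_inf (negPart_nonneg _) (negPart_nonneg _))
  have h1 : (-x) ⊓ (-y) ≤ 0 := by rw [← neg_sup]; exact neg_nonpos.2 h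
  let _ := AddCommGroup.toDistribLattice E
  calc x⁻ ⊓ y⁻ = (-x) ⊓ (-y) ⊔ 0 := by rw [negPart_def, negPart_def, sup_inf_right]
    _ ≤ 0 := sup_le h1 le_rfl

theorem glue_le {E : Type u} [CommRing E] [PartialOrder E] [IsOrderedAddMonoid E] {e x y t : E}
    (hy : e * y ≤ e * t) (hx : (1 - e) * x ≤ (1 - e) * t) : e * y + (1 - e) * x ≤ t :=
  (add_le_add hy hx).trans_eq (by ring)

section Commutative

variable {E : Type u} [CommRing E] [Algebra ℝ E] [ConditionallyCompleteLattice E]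
  [IsOrderedAddMonoid E] [IsFAlgebra E]

theorem glue_mem_Icc (B : Submodule ℝ E) {l l' r r' x y : E} (hx : x ∈ Icc l r)
    (hy : y ∈ Icc l' r') : bandProj B 1 * y + (1 - bandProj B 1) * x ∈
      Icc (bandProj B 1 * l' + (1 - bandProj B 1) * l)
        (bandProj B 1 * r' + (1 - bandProj B 1) * r) := by
  have h0 := bandProj_one_nonneg B
  have h1 := sub_nonneg.2 (bandProj_one_le B)
  exact ⟨add_le_add (mul_le_mul_of_nonneg_left hy.1 h0) (mul_le_mul_of_nonneg_left hx.1 h1),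
    add_le_add (mul_le_mul_of_nonneg_left hy.2 h0) (mul_le_mul_of_nonneg_left hx.2 h1)⟩

theorem LocallyBandPreservingOn.neg {f : E → E} {D : Set E}
    (hf : LocallyBandPreservingOn f D) : LocallyBandPreservingOn (fun z => -f z) D := by
  intro B hB x hx y hy h
  have := hf B hB x hx y hy h
  rw [bandProj_eq_mul hB] at this ⊢
  rw [bandProj_eq_mul hB (f y)] at this
  rw [bandProj_eq_mul hB (-f y), mul_neg, mul_neg, this]

variable [PosSMulMono ℝ E]

/-- A locally band preserving function takes equal values where its arguments agree. -/
theorem LocallyBandPreservingOn.mul_eq {f : E → E} {D : Set E}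
    (hf : LocallyBandPreservingOn f D) {x y v : E} (hx : x ∈ D) (hy : y ∈ D)
    (h : |x - y| ⊓ |v| = 0) : f x * v = f y * v := by
  obtain ⟨B, hB, h1, h2⟩ := exists_band_carrier v
  have h3 := h2 _ h
  rw [mul_sub, sub_eq_zero, ← bandProj_eq_mul hB, ← bandProj_eq_mul hB] at h3
  have h4 := hf B hB x hx y hy h3
  rw [bandProj_eq_mul hB (f x), bandProj_eq_mul hB (f y)] at h4
  rw [← h1, ← mul_assoc, ← mul_assoc, mul_comm (f x), mul_comm (f y), h4]

/-- Gluing: on the component `e` of the unit `f` only sees `y`, on `1 - e` only `x`. -/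
theorem LocallyBandPreservingOn.apply_glue {f : E → E} {D : Set E}
    (hf : LocallyBandPreservingOn f D) {B : Submodule ℝ E} (hB : IsBand B) {x y z : E}
    (hx : x ∈ D) (hy : y ∈ D) (hz : z ∈ D)
    (hzy : bandProj B 1 * z = bandProj B 1 * y)
    (hzx : (1 - bandProj B 1) * z = (1 - bandProj B 1) * x) :
    f z = bandProj B 1 * f y + (1 - bandProj B 1) * f x := by
  have hee := bandProj_one_mul_self hB
  have h1 : bandProj B 1 * f z = bandProj B 1 * f y := by
    rw [← bandProj_eq_mul hB, ← bandProj_eq_mul hB]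
    exact hf B hB z hz y hy (by rw [bandProj_eq_mul hB z, bandProj_eq_mul hB y, hzy])
  -- `z` and `x` differ by a multiple of `e`, hence agree on the disjoint complement of the band
  have hmem : z - x ∈ B := by
    have : z - x = bandProj B (z - x) := by
      rw [bandProj_eq_mul hB]; linear_combination hzx
    rw [this]; exact bandProj_mem hB _
  have h2 : f z * (1 - bandProj B 1) = f x * (1 - bandProj B 1) := by
    refine hf.mul_eq hz hx ?_
    rw [inf_comm]; exact sub_bandProj_disjoint hB 1 hmem
  linear_combination h1 + h2

/-- An upper bound for the values on the two halves of an interval bounds all values. -/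
theorem le_of_le_halves {f : E → E} {D : Set E} (hf : LocallyBandPreservingOn f D)
    {l m r t : E} (hD : Icc l r ⊆ D) (hlm : l ≤ m) (hmr : m ≤ r)
    (hL : ∀ z ∈ Icc l m, f z ≤ t) (hR : ∀ z ∈ Icc m r, f z ≤ t) : ∀ z ∈ Icc l r, f z ≤ t := by
  intro z hz
  obtain ⟨B, hB, h1, h2⟩ := exists_band_carrier ((z - m)⁺ : E)
  have hn : bandProj B 1 * (z - m)⁻ = 0 := h2 _ (by
    rw [abs_of_nonneg (negPart_nonneg _), abs_of_nonneg (posPart_nonneg _), inf_comm]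
    exact posPart_inf_negPart_eq_zero _)
  have e1 : z - z ⊓ m = (z - m)⁺ := sub_inf_eq_posPart z m
  have e2 : z ⊔ m = z + (z - m)⁻ := by
    rw [sup_comm, sup_eq_add_posPart_sub, ← neg_sub z m, posPart_neg]
  have hx : z ⊓ m ∈ Icc l m := ⟨le_inf hz.1 hlm, inf_le_right⟩
  have hy : z ⊔ m ∈ Icc m r := ⟨le_sup_right, sup_le hz.2 hmr⟩
  rw [hf.apply_glue hB (hD ⟨hx.1, hx.2.trans hmr⟩) (hD ⟨hlm.trans hy.1, hy.2⟩) (hD hz)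
    (by rw [e2, mul_add, hn, add_zero]) (by linear_combination (1 - bandProj B 1) * e1 - h1)]
  exact glue_le (mul_le_mul_of_nonneg_left (hR _ hy) (bandProj_one_nonneg B))
    (mul_le_mul_of_nonneg_left (hL _ hx) (sub_nonneg.2 (bandProj_one_le B)))

/-- `0` lies locally between the infimum and the supremum of the values of `F` on `[l, r]`: every
upper bound of the values is nonnegative and every lower bound is nonpositive. -/
def Straddles (F : E → E) (l r : E) : Prop :=
  (∀ t, (∀ z ∈ Icc l r, F z ≤ t) → 0 ≤ t) ∧ ∀ t, (∀ z ∈ Icc l r, t ≤ F z) → t ≤ 0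

/-- One of the two inequalities in a bisection step: if the supremum `ML` of the values on `[l, m]`
is nonnegative off the band `B` and the supremum `MR` of those on `[m, r]` is nonnegative on `B`,
then the interval that equals `[m, r]` on `B` and `[l, m]` off `B` has only nonnegative upper bounds
of its values. -/
theorem nonneg_of_glue {F : E → E} {D : Set E} (hF : LocallyBandPreservingOn F D)
    {l m r : E} (hD : Icc l r ⊆ D) (hlm : l ≤ m) (hmr : m ≤ r)
    {B : Submodule ℝ E} (hB : IsBand B) {ML MR : E} (hML : IsLUB (F '' Icc l m) ML)
    (hMR : IsLUB (F '' Icc m r) MR) (hL : 0 ≤ (1 - bandProj B 1) * ML)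
    (hR : 0 ≤ bandProj B 1 * MR) {t : E}
    (ht : ∀ z ∈ Icc (bandProj B 1 * m + (1 - bandProj B 1) * l)
      (bandProj B 1 * r + (1 - bandProj B 1) * m), F z ≤ t) : 0 ≤ t := by
  have h0 := bandProj_one_nonneg B
  have h1 := sub_nonneg.2 (bandProj_one_le B)
  have hee := bandProj_one_mul_self hB
  have hval : ∀ x ∈ Icc l m, ∀ y ∈ Icc m r,
      bandProj B 1 * F y + (1 - bandProj B 1) * F x ≤ t := fun x hx y hy => by
    have hxD : x ∈ Icc l r := ⟨hx.1, hx.2.trans hmr⟩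
    have hyD : y ∈ Icc l r := ⟨hlm.trans hy.1, hy.2⟩
    have hz := glue_mem_Icc B hxD hyD
    rw [show bandProj B 1 * l + (1 - bandProj B 1) * l = l by ring,
      show bandProj B 1 * r + (1 - bandProj B 1) * r = r by ring] at hz
    rw [← hF.apply_glue hB (hD hxD) (hD hyD) (hD hz)
      (by linear_combination (y - x) * hee) (by linear_combination (x - y) * hee)]
    exact ht _ (glue_mem_Icc B hx hy)
  have key : ∀ s : E, bandProj B 1 * (bandProj B 1 * s) = bandProj B 1 * s := fun s => by
    rw [← mul_assoc, hee]
  have htR : bandProj B 1 * MR ≤ bandProj B 1 * t := by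
    have : MR ≤ bandProj B 1 * t + (1 - bandProj B 1) * MR := hMR.2 (by
      rintro _ ⟨y, hy, rfl⟩
      have h2 := mul_le_mul_of_nonneg_left (hval l ⟨le_rfl, hlm⟩ y hy) h0
      have h3 := mul_le_mul_of_nonneg_left (hMR.1 ⟨y, hy, rfl⟩) h1
      have e : bandProj B 1 * (bandProj B 1 * F y + (1 - bandProj B 1) * F l)
          = bandProj B 1 * F y := by linear_combination (F y - F l) * hee
      rw [e] at h2
      calc F y = bandProj B 1 * F y + (1 - bandProj B 1) * F y := by ring
        _ ≤ _ := add_le_add h2 h3)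
    have h4 := mul_le_mul_of_nonneg_left this h0
    refine h4.trans_eq ?_
    linear_combination (t - MR) * hee
  have htL : (1 - bandProj B 1) * ML ≤ (1 - bandProj B 1) * t := by
    have : ML ≤ (1 - bandProj B 1) * t + bandProj B 1 * ML := hML.2 (by
      rintro _ ⟨x, hx, rfl⟩
      have h2 := mul_le_mul_of_nonneg_left (hval x hx m ⟨le_rfl, hmr⟩) h1
      have h3 := mul_le_mul_of_nonneg_left (hML.1 ⟨x, hx, rfl⟩) h0
      have e : (1 - bandProj B 1) * (bandProj B 1 * F m + (1 - bandProj B 1) * F x)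
          = (1 - bandProj B 1) * F x := by linear_combination (F x - F m) * hee
      rw [e] at h2
      calc F x = (1 - bandProj B 1) * F x + bandProj B 1 * F x := by ring
        _ ≤ _ := add_le_add h2 h3)
    have h4 := mul_le_mul_of_nonneg_left this h1
    refine h4.trans_eq ?_
    linear_combination (t - ML) * hee
  calc (0 : E) ≤ bandProj B 1 * MR + (1 - bandProj B 1) * ML := add_nonneg hR hL
    _ ≤ t := glue_le htR htL

/-- Bisection step. With `ML`, `mL` the supremum and infimum of the values on the left half, the
left half is kept where `mL ≤ 0 ≤ ML`. Elsewhere the value at the midpoint, which belongs to both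
halves, forces `0` to lie between the bounds on the right half. -/
theorem Straddles.bisect {F : E → E} {D : Set E} (hF : LocallyBandPreservingOn F D) {l r : E}
    (hlr : l ≤ r) (hD : Icc l r ⊆ D) (hbelow : BddBelow (F '' Icc l r))
    (habove : BddAbove (F '' Icc l r)) (h : Straddles F l r) :
    ∃ l' r', l ≤ l' ∧ l' ≤ r' ∧ r' ≤ r ∧ r' - l' = (1 / 2 : ℝ) • (r - l) ∧ Straddles F l' r' := by
  set m : E := l + (1 / 2 : ℝ) • (r - l) with hm
  have hhalf : (0 : E) ≤ (1 / 2 : ℝ) • (r - l) :=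
    smul_nonneg (by norm_num) (sub_nonneg.2 hlr)
  have hrm : r - m = (1 / 2 : ℝ) • (r - l) := by
    rw [hm, ← sub_sub, sub_eq_iff_eq_add, ← add_smul]; norm_num
  have hlm : l ≤ m := le_add_of_nonneg_right hhalf
  have hmr : m ≤ r := sub_nonneg.1 (hrm ▸ hhalf)
  have hIL : Icc l m ⊆ Icc l r := Icc_subset_Icc_right hmr
  have hIR : Icc m r ⊆ Icc l r := Icc_subset_Icc_left hlm
  have hneL : (F '' Icc l m).Nonempty := ⟨_, l, ⟨le_rfl, hlm⟩, rfl⟩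
  have hneR : (F '' Icc m r).Nonempty := ⟨_, m, ⟨le_rfl, hmr⟩, rfl⟩
  have hML := isLUB_csSup hneL (habove.mono (image_mono hIL))
  have hMR := isLUB_csSup hneR (habove.mono (image_mono hIR))
  have hmL := isGLB_csInf hneL (hbelow.mono (image_mono hIL))
  have hmR := isGLB_csInf hneR (hbelow.mono (image_mono hIR))
  set ML := sSup (F '' Icc l m)
  set MR := sSup (F '' Icc m r)
  set mL := sInf (F '' Icc l m)
  set mR := sInf (F '' Icc m r)
  have hmidL : F m ∈ F '' Icc l m := ⟨m, ⟨hlm, le_rfl⟩, rfl⟩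
  have hmidR : F m ∈ F '' Icc m r := ⟨m, ⟨le_rfl, hmr⟩, rfl⟩
  have hF' := hF.neg
  have hsup : 0 ≤ MR ⊔ ML := h.1 _ (le_of_le_halves hF hD hlm hmr
    (fun z hz => (hML.1 ⟨z, hz, rfl⟩).trans le_sup_right)
    (fun z hz => (hMR.1 ⟨z, hz, rfl⟩).trans le_sup_left))
  have hinf : 0 ≤ (-mR) ⊔ (-mL) := by
    rw [← neg_inf, neg_nonneg]
    refine h.2 _ fun z hz => neg_le_neg_iff.1 (le_of_le_halves hF' hD hlm hmr
      (fun z hz => neg_le_neg (inf_le_right.trans (hmL.1 ⟨z, hz, rfl⟩)))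
      (fun z hz => neg_le_neg (inf_le_left.trans (hmR.1 ⟨z, hz, rfl⟩))) z hz)
  -- `B` is the band on which `mL ≤ 0 ≤ ML` fails
  obtain ⟨B, hB, hk1, hk2⟩ := exists_band_carrier ((ML ⊓ -mL)⁻ : E)
  set k := ML ⊓ -mL with hk
  have hkle : k⁻ ≤ ML⁻ + (-mL)⁻ := by
    rw [negPart_def, hk, neg_inf]
    have a1 := negPart_nonneg ML
    have a2 := negPart_nonneg (-mL)
    exact sup_le (sup_le ((neg_le_negPart _).trans (le_add_of_nonneg_right a2))
      ((neg_le_negPart _).trans (le_add_of_nonneg_left a1))) (add_nonneg a1 a2)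
  have kill : ∀ w : E, w⁻ ⊓ ML⁻ = 0 → w⁻ ⊓ (-mL)⁻ = 0 → 0 ≤ bandProj B 1 * w := by
    intro w h1 h2
    have h3 : bandProj B 1 * w⁻ = 0 := hk2 _ (by
      rw [abs_of_nonneg (negPart_nonneg _), abs_of_nonneg (negPart_nonneg _)]
      refine le_antisymm ((inf_le_inf_left _ hkle).trans ?_)
        (le_inf (negPart_nonneg _) (negPart_nonneg _))
      rw [inf_comm]
      refine (add_inf_le (negPart_nonneg _) (negPart_nonneg _) (negPart_nonneg _)).trans ?_
      rw [inf_comm, h1, inf_comm, h2, add_zero])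
    rw [← posPart_sub_negPart w, mul_sub, h3, sub_zero]
    exact mul_nonneg (bandProj_one_nonneg B) (posPart_nonneg w)
  have hpn : ∀ p q w : E, w ≤ p → -w ≤ q → p⁻ ⊓ q⁻ = 0 := fun p q w hp hq => by
    refine le_antisymm ?_ (le_inf (negPart_nonneg _) (negPart_nonneg _))
    refine (inf_le_inf (negPart_anti hp) (negPart_anti hq)).trans ?_
    rw [negPart_neg, inf_comm, posPart_inf_negPart_eq_zero]
  -- where `ML < 0`, `MR` makes up for it by `hsup`; where `0 < mL`, `MR ≥ F m ≥ mL > 0`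
  have hR1 : 0 ≤ bandProj B 1 * MR := kill _ (negPart_inf_eq_zero_of_nonneg_sup hsup)
    (hpn _ _ (F m) (hMR.1 hmidR) (neg_le_neg (hmL.1 hmidL)))
  have hR2 : 0 ≤ bandProj B 1 * -mR := kill _
    (hpn _ _ (-F m) (neg_le_neg (hmR.1 hmidR)) (by rw [neg_neg]; exact hML.1 hmidL))
    (negPart_inf_eq_zero_of_nonneg_sup hinf)
  have h1 := sub_nonneg.2 (bandProj_one_le B)
  have hk0 : 0 ≤ (1 - bandProj B 1) * k := by
    have : (1 - bandProj B 1) * k = (1 - bandProj B 1) * k⁺ := by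
      conv_lhs => rw [← posPart_sub_negPart k]
      linear_combination hk1
    rw [this]; exact mul_nonneg h1 (posPart_nonneg _)
  have hL1 : 0 ≤ (1 - bandProj B 1) * ML := hk0.trans (mul_le_mul_of_nonneg_left inf_le_left h1)
  have hL2 : 0 ≤ (1 - bandProj B 1) * -mL := hk0.trans (mul_le_mul_of_nonneg_left inf_le_right h1)
  have hglue := glue_mem_Icc B (l := l) (r := r) (x := l) (l' := l) (r' := r) (y := m)
    ⟨le_rfl, hlr⟩ ⟨hlm, hmr⟩
  have hglue' := glue_mem_Icc B (l := l) (r := r) (x := m) (l' := l) (r' := r) (y := r)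
    ⟨hlm, hmr⟩ ⟨hlr, le_rfl⟩
  rw [show bandProj B 1 * l + (1 - bandProj B 1) * l = l by ring,
    show bandProj B 1 * r + (1 - bandProj B 1) * r = r by ring] at hglue hglue'
  have hneg : ∀ (s : Set E) (x : E), IsGLB (F '' s) x → IsLUB ((fun z => -F z) '' s) (-x) := by
    intro s x hx
    have := hx.neg
    rwa [← image_neg_eq_neg, image_image] at this
  refine ⟨_, _, hglue.1, ?_, hglue'.2, ?_, ?_, ?_⟩
  · exact add_le_add (mul_le_mul_of_nonneg_left hmr (bandProj_one_nonneg B))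
      (mul_le_mul_of_nonneg_left hlm h1)
  · have hml : m - l = (1 / 2 : ℝ) • (r - l) := by rw [hm]; abel
    linear_combination bandProj B 1 * hrm + (1 - bandProj B 1) * hml
  · exact fun t ht => nonneg_of_glue hF hD hlm hmr hB hML hMR hL1 hR1 ht
  · intro t ht
    refine neg_nonneg.1 (nonneg_of_glue hF' hD hlm hmr hB (hneg _ _ hmL) (hneg _ _ hmR) hL2 hR2
      fun z hz => neg_le_neg (ht z hz))

/-- Intermediate value theorem. The hypothesis `hcont` says that at each point `c` the bounds `e`
for `|F z - F c|` over the points `z` at distance at most `2⁻ⁿ (q - p)` from `c`, taken for all `n`,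
have infimum `0`. -/
theorem exists_eq_zero_of_straddles {F : E → E} {p q : E} (hpq : p ≤ q)
    (hF : LocallyBandPreservingOn F (Icc p q)) (hbelow : BddBelow (F '' Icc p q))
    (habove : BddAbove (F '' Icc p q)) (h : Straddles F p q)
    (hcont : ∀ c ∈ Icc p q, ∀ w : E,
      (∀ n : ℕ, ∀ e : E, (∀ z ∈ Icc p q, |z - c| ≤ (1 / 2 : ℝ) ^ n • (q - p) → |F z - F c| ≤ e) →
        w ≤ e) → w ≤ 0) :
    ∃ c ∈ Icc p q, F c = 0 := by
  let T := {i : E × E // p ≤ i.1 ∧ i.1 ≤ i.2 ∧ i.2 ≤ q ∧ Straddles F i.1 i.2}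
  have step : ∀ i : T, ∃ j : T, i.1.1 ≤ j.1.1 ∧ j.1.2 ≤ i.1.2 ∧
      j.1.2 - j.1.1 = (1 / 2 : ℝ) • (i.1.2 - i.1.1) := by
    rintro ⟨⟨l, r⟩, hl, hlr, hr, hs⟩
    have hsub : Icc l r ⊆ Icc p q := Icc_subset_Icc hl hr
    obtain ⟨l', r', h1, h2, h3, h4, h5⟩ := hs.bisect hF hlr hsub
      (hbelow.mono (image_mono hsub)) (habove.mono (image_mono hsub))
    exact ⟨⟨(l', r'), hl.trans h1, h2, h3.trans hr, h5⟩, h1, h3, h4⟩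
  choose next hn1 hn2 hn3 using step
  let s : ℕ → T := fun n => Nat.rec ⟨(p, q), le_rfl, hpq, le_rfl, h⟩ (fun _ i => next i) n
  have hs : ∀ n, s (n + 1) = next (s n) := fun n => rfl
  have hmono : Monotone fun n => (s n).1.1 := monotone_nat_of_le_succ fun n => hn1 (s n)
  have hanti : Antitone fun n => (s n).1.2 := antitone_nat_of_succ_le fun n => hn2 (s n)
  have hlen : ∀ n, (s n).1.2 - (s n).1.1 = (1 / 2 : ℝ) ^ n • (q - p) := by
    intro n
    induction n with
    | zero => simp [s]
    | succ n ih => rw [hs, hn3, ih, smul_smul, pow_succ']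
  have hub : ∀ n, (s n).1.2 ∈ upperBounds (range fun n => (s n).1.1) := by
    rintro n _ ⟨k, rfl⟩
    exact (hmono (le_max_left k n)).trans ((s (max k n)).2.2.1.trans (hanti (le_max_right k n)))
  have hlub := isLUB_csSup (range_nonempty fun n => (s n).1.1) ⟨_, hub 0⟩
  set c := sSup (range fun n => (s n).1.1)
  have hc : ∀ n, c ∈ Icc (s n).1.1 (s n).1.2 := fun n => ⟨hlub.1 ⟨n, rfl⟩, hlub.2 (hub n)⟩
  have hcpq : c ∈ Icc p q := hc 0
  have hclose : ∀ n, ∀ z ∈ Icc (s n).1.1 (s n).1.2, |z - c| ≤ (1 / 2 : ℝ) ^ n • (q - p) := by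
    intro n z hz
    rw [← hlen n]
    refine abs_le'.2 ⟨sub_le_sub hz.2 (hc n).1, ?_⟩
    rw [neg_sub]
    exact sub_le_sub (hc n).2 hz.1
  have hin : ∀ n, ∀ z ∈ Icc (s n).1.1 (s n).1.2, z ∈ Icc p q := fun n z hz =>
    ⟨(s n).2.1.trans hz.1, hz.2.trans (s n).2.2.2.1⟩
  refine ⟨c, hcpq, le_antisymm (hcont c hcpq _ fun n e he => ?_) (neg_nonpos.1
    (hcont c hcpq _ fun n e he => ?_))⟩
  · have := (s n).2.2.2.2.2 (F c - e) fun z hz => by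
      have := (neg_le_abs _).trans (he z (hin n z hz) (hclose n z hz))
      rw [neg_sub] at this
      exact sub_le_comm.1 this
    exact sub_nonpos.1 this
  · have := (s n).2.2.2.2.1 (F c + e) fun z hz => by
      have := (le_abs_self _).trans (he z (hin n z hz) (hclose n z hz))
      exact sub_le_iff_le_add'.1 this
    exact neg_le_iff_add_nonneg'.2 this

end Commutative

/-- The points `z ∈ D` at distance at most `2⁻ⁿ d` from `c`, paired with the exponent `n` and
preordered by it: the index set of a net in `D` that converges to `c`. -/
structure NearPoint {E : Type u} [AddCommGroup E] [Module ℝ E] [Lattice E] (D : Set E)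
    (c d : E) where
  n : ℕ
  z : E
  mem : z ∈ D
  near : |z - c| ≤ (1 / 2 : ℝ) ^ n • d

instance {E : Type u} [AddCommGroup E] [Module ℝ E] [Lattice E] (D : Set E) (c d : E) :
    Preorder (NearPoint D c d) :=
  Preorder.lift NearPoint.n

/-- Order continuity gives a modulus of continuity at each point, uniform over the points at
distance at most `2⁻ⁿ d`. -/
theorem OrderContinuousOn.exists_modulus {E : Type u} [AddCommGroup E] [Module ℝ E]
    [ConditionallyCompleteLattice E] [IsOrderedAddMonoid E] [PosSMulMono ℝ E]
    {f : E → E} {D : Set E} (hf : OrderContinuousOn f D)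
    {c d : E} (hc : c ∈ D) (hd : 0 ≤ d) :
    ∃ S : Set E, IsGLB S 0 ∧ ∀ ε ∈ S, ∃ n : ℕ, ∀ z ∈ D, |z - c| ≤ (1 / 2 : ℝ) ^ n • d →
      |f z - f c| ≤ ε := by
  have hc0 : ∀ n : ℕ, |c - c| ≤ (1 / 2 : ℝ) ^ n • d := fun n => by
    rw [sub_self, abs_zero]; exact smul_nonneg (by positivity) hd
  have hne : Nonempty (NearPoint D c d) := ⟨⟨0, c, hc, hc0 0⟩⟩
  have hdir : IsDirectedOrder (NearPoint D c d) := ⟨fun i j => ⟨⟨max i.n j.n, c, hc, hc0 _⟩,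
    le_max_left i.n j.n, le_max_right i.n j.n⟩⟩
  obtain ⟨S, hS, h⟩ := hf c hc (NearPoint D c d) NearPoint.z NearPoint.mem
    ⟨_, isGLB_range_pow_smul hd, by
      rintro _ ⟨n, rfl⟩
      refine ⟨⟨n, c, hc, hc0 n⟩, fun i hi => i.near.trans ?_⟩
      exact smul_le_smul_of_nonneg_right
        (pow_le_pow_of_le_one (by norm_num) (by norm_num) (show n ≤ i.n from hi)) hd⟩
  refine ⟨S, hS, fun ε hε => ?_⟩
  obtain ⟨i₀, hi⟩ := h ε hε
  exact ⟨i₀.n, fun z hz hzc => hi ⟨i₀.n, z, hz, hzc⟩ (le_refl i₀.n)⟩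

/-! ### Overlaps of intervals -/

section Overlap

variable {E : Type u} [AddCommGroup E] [Lattice E]

/-- The length of the part that the intervals `[s, t]` and `[u, v]` have in common, computed as if
in a totally ordered group. -/
def overlap (s t u v : E) : E := (t ⊓ v - s ⊔ u)⁺

theorem overlap_nonneg (s t u v : E) : 0 ≤ overlap s t u v := posPart_nonneg _

theorem overlap_comm (s t u v : E) : overlap s t u v = overlap u v s t := by
  rw [overlap, overlap, inf_comm, sup_comm]

variable [IsOrderedAddMonoid E]

/-- The overlap is the length of `[u, v]` after truncation to `[s, t]`. -/
theorem clamp_sub_clamp {s t u v : E} (hst : s ≤ t) (huv : u ≤ v) :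
    (v ⊔ s) ⊓ t - (u ⊔ s) ⊓ t = overlap s t u v := by
  let _ := AddCommGroup.toDistribLattice E
  have e0 : (v ⊔ s) ⊓ t = (t ⊓ v) ⊔ s := by
    rw [inf_sup_right, inf_eq_left.2 hst, inf_comm]
  -- `α = t ⊓ v` and `β = s ⊔ u` satisfy `(α ⊔ s) ⊔ β = α ⊔ β` and `(α ⊔ s) ⊓ β = (u ⊔ s) ⊓ t`
  have e1 : ((t ⊓ v) ⊔ s) ⊔ (s ⊔ u) = (t ⊓ v) ⊔ (s ⊔ u) := by
    rw [sup_assoc, ← sup_assoc s s u, sup_idem]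
  have e2 : ((t ⊓ v) ⊔ s) ⊓ (s ⊔ u) = (u ⊔ s) ⊓ t := by
    rw [sup_comm (t ⊓ v) s, ← sup_inf_left, inf_assoc, inf_eq_right.2 huv, inf_sup_right,
      inf_eq_left.2 hst, inf_comm t u, sup_comm]
  have e3 := inf_add_sup ((t ⊓ v) ⊔ s) (s ⊔ u)
  rw [e1, e2] at e3
  rw [e0, overlap, ← sup_sub_eq_posPart, sub_eq_sub_iff_add_eq_add, ← e3, add_comm]

/-- A point of the truncation of `[s, t]` to `[u, v]` belongs to `[s, t]` where the overlap of the
two intervals does not vanish. -/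
theorem sub_clamp_disjoint {s t u v z : E} (hst : s ≤ t)
    (hz : z ∈ Icc ((s ⊔ u) ⊓ v) ((t ⊔ u) ⊓ v)) :
    |z - (z ⊔ s) ⊓ t| ⊓ |overlap s t u v| = 0 := by
  have hsplit : z - (z ⊔ s) ⊓ t = (z - t)⁺ - (s - z)⁺ := by
    have h1 : (z ⊔ s) - (z ⊔ s) ⊓ t = (z - t)⁺ := by
      rw [sub_inf_eq_posPart, ← sup_sub_eq_posPart z t, ← sup_sub_eq_posPart, sup_assoc,
        sup_eq_right.2 hst]
    have h2 : (z ⊔ s) - z = (s - z)⁺ := by rw [sup_comm, sup_sub_eq_posPart]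
    rw [← h1, ← h2]; abel
  have hov1 : overlap s t u v ≤ (t - u)⁺ := posPart_mono (sub_le_sub inf_le_left le_sup_right)
  have hov2 : overlap s t u v ≤ (v - s)⁺ := posPart_mono (sub_le_sub inf_le_right le_sup_left)
  have h1 : (z - t)⁺ ≤ (u - t)⁺ := by
    rw [← sup_sub_eq_posPart u t, sup_comm]
    refine sup_le (sub_le_sub_right (hz.2.trans inf_le_left) _) ?_
    exact sub_nonneg.2 le_sup_left
  have h2 : (s - z)⁺ ≤ (s - v)⁺ := by
    refine sup_le ?_ (posPart_nonneg _)
    calc s - z ≤ s - (s ⊔ u) ⊓ v := sub_le_sub_left hz.1 _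
      _ ≤ s - s ⊓ v := sub_le_sub_left (inf_le_inf_right _ le_sup_left) _
      _ = (s - v)⁺ := sub_inf_eq_posPart s v
  rw [hsplit, sub_eq_add_neg]
  have hao : |overlap s t u v| = overlap s t u v := abs_of_nonneg (overlap_nonneg _ _ _ _)
  refine abs_inf_add ?_ ?_
  · exact abs_inf_abs_eq_zero_of_le (by rwa [abs_of_nonneg (posPart_nonneg _)])
      (by rwa [hao]) (posPart_sub_inf_posPart_sub u t)
  · exact abs_inf_abs_eq_zero_of_le (by rwa [abs_neg, abs_of_nonneg (posPart_nonneg _)])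
      (by rwa [hao]) (posPart_sub_inf_posPart_sub s v)

end Overlap

/-! ### Comparison and restriction of Darboux sums -/

namespace IntervalPartition

variable {E : Type u}

theorem mem_Icc [Lattice E] {a b : E} (P : IntervalPartition a b) {i : ℕ} (hi : i ≤ P.n) :
    P.x i ∈ Icc a b := by
  constructor
  · induction i with
    | zero => exact P.left.ge
    | succ i ih => exact (ih (by omega)).trans (P.le_succ i (by omega))
  · induction hi using Nat.decreasingInduction with
    | self => exact P.right.le
    | of_succ k hk ih => exact (P.le_succ k hk).trans ih

theorem Icc_subset [Lattice E] {a b : E} (P : IntervalPartition a b) {i : ℕ} (hi : i < P.n) :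
    Icc (P.x i) (P.x (i + 1)) ⊆ Icc a b :=
  Icc_subset_Icc (P.mem_Icc hi.le).1 (P.mem_Icc hi).2

/-- The partition of `[a, b]` without intermediate points. -/
def trivial [Lattice E] {a b : E} (h : a ≤ b) : IntervalPartition a b where
  n := 1
  x i := if i = 0 then a else b
  le_succ i hi := by
    obtain rfl : i = 0 := by omega
    simpa using h
  left := rfl
  right := rfl

/-- The partition of a subinterval `[u, v]` of `[a, b]` obtained by truncating the points of a
partition of `[a, b]` to `[u, v]`. -/
def clamp [Lattice E] {a b u v : E} (P : IntervalPartition a b) (hau : a ≤ u) (huv : u ≤ v)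
    (hvb : v ≤ b) : IntervalPartition u v where
  n := P.n
  x i := (P.x i ⊔ u) ⊓ v
  le_succ i hi := inf_le_inf_right _ (sup_le_sup_right (P.le_succ i hi) _)
  left := by rw [P.left, sup_eq_right.2 hau, inf_eq_left.2 huv]
  right := by rw [P.right, sup_eq_left.2 (huv.trans hvb), inf_eq_right.2 hvb]

theorem sum_overlap [AddCommGroup E] [Lattice E] [IsOrderedAddMonoid E] {a b s t : E}
    (P : IntervalPartition a b) (has : a ≤ s) (hst : s ≤ t) (htb : t ≤ b) :
    ∑ i ∈ Finset.range P.n, overlap s t (P.x i) (P.x (i + 1)) = t - s := by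
  calc ∑ i ∈ Finset.range P.n, overlap s t (P.x i) (P.x (i + 1))
      = ∑ i ∈ Finset.range P.n, ((P.x (i + 1) ⊔ s) ⊓ t - (P.x i ⊔ s) ⊓ t) :=
        Finset.sum_congr rfl fun i hi =>
          (clamp_sub_clamp hst (P.le_succ i (Finset.mem_range.1 hi))).symm
    _ = t - s := by
      rw [Finset.sum_range_sub (fun i => (P.x i ⊔ s) ⊓ t), P.left, P.right,
        sup_eq_left.2 (hst.trans htb), inf_eq_right.2 htb, sup_eq_right.2 has, inf_eq_left.2 hst]

theorem clamp_step [AddCommGroup E] [Lattice E] [IsOrderedAddMonoid E] {a b u v : E}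
    (P : IntervalPartition a b) (hau : a ≤ u) (huv : u ≤ v) (hvb : v ≤ b) {i : ℕ} (hi : i < P.n) :
    (P.clamp hau huv hvb).x (i + 1) - (P.clamp hau huv hvb).x i =
      overlap (P.x i) (P.x (i + 1)) u v := by
  rw [overlap_comm]; exact clamp_sub_clamp huv (P.le_succ i hi)

end IntervalPartition

section Sums

theorem sum_mul_step_eq {E : Type u} [CommRing E] [Lattice E] [IsOrderedAddMonoid E] {a b : E}
    (P : IntervalPartition a b) {p q : E} (hap : a ≤ p)
    (hpq : p ≤ q) (hqb : q ≤ b) (M : ℕ → E) :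
    ∑ i ∈ Finset.range P.n, M i * (P.x (i + 1) - P.x i) =
      ∑ i ∈ Finset.range P.n, M i * overlap (P.x i) (P.x (i + 1)) a p +
      ∑ i ∈ Finset.range P.n, M i * overlap (P.x i) (P.x (i + 1)) p q +
      ∑ i ∈ Finset.range P.n, M i * overlap (P.x i) (P.x (i + 1)) q b := by
  rw [← Finset.sum_add_distrib, ← Finset.sum_add_distrib]
  refine Finset.sum_congr rfl fun i hi => ?_
  have hi := Finset.mem_range.1 hi
  have hst := P.le_succ i hi
  rw [← clamp_sub_clamp hst hap, ← clamp_sub_clamp hst hpq, ← clamp_sub_clamp hst hqb,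
    sup_eq_right.2 (P.mem_Icc hi.le).1, inf_eq_left.2 hst,
    sup_eq_left.2 (P.mem_Icc hi.le).2, inf_eq_right.2 (P.mem_Icc hi).2]
  ring

theorem LocallyBandPreservingOn.mono {E : Type u} [AddCommGroup E] [Module ℝ E]
    [ConditionallyCompleteLattice E] {f : E → E} {D D' : Set E} (hf : LocallyBandPreservingOn f D)
    (h : D' ⊆ D) : LocallyBandPreservingOn f D' :=
  fun B hB x hx y hy => hf B hB x (h hx) y (h hy)

variable {E : Type u} [CommRing E] [Algebra ℝ E] [ConditionallyCompleteLattice E]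
  [IsOrderedAddMonoid E] [PosSMulMono ℝ E] [IsFAlgebra E] {f : E → E} {a b : E}

/-- Where `[s, t]` and `[u, v]` overlap they have a point in common, so that the infimum of `f` over
the one is at most the supremum of `f` over the other. -/
theorem sInf_mul_overlap_le_sSup_mul_overlap (hf : LocallyBandPreservingOn f (Icc a b))
    (hbelow : BddBelow (f '' Icc a b)) (habove : BddAbove (f '' Icc a b)) {s t u v : E}
    (hst : s ≤ t) (huv : u ≤ v) (hs : Icc s t ⊆ Icc a b) (hu : Icc u v ⊆ Icc a b) :
    sInf (f '' Icc s t) * overlap s t u v ≤ sSup (f '' Icc u v) * overlap s t u v := by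
  have hz : (s ⊔ u) ⊓ v ∈ Icc u v := ⟨le_inf le_sup_right huv, inf_le_right⟩
  have hw : ((s ⊔ u) ⊓ v ⊔ s) ⊓ t ∈ Icc s t := ⟨le_inf le_sup_right hst, inf_le_right⟩
  have h := hf.mul_eq (hu hz) (hs hw)
    (sub_clamp_disjoint hst ⟨le_rfl, inf_le_inf_right _ (sup_le_sup_right hst _)⟩)
  calc sInf (f '' Icc s t) * overlap s t u v ≤ f (((s ⊔ u) ⊓ v ⊔ s) ⊓ t) * overlap s t u v :=
        mul_le_mul_of_nonneg_right (csInf_le (hbelow.mono (image_mono hs)) ⟨_, hw, rfl⟩)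
          (overlap_nonneg _ _ _ _)
    _ = f ((s ⊔ u) ⊓ v) * overlap s t u v := h.symm
    _ ≤ _ := mul_le_mul_of_nonneg_right (le_csSup (habove.mono (image_mono hu)) ⟨_, hz, rfl⟩)
          (overlap_nonneg _ _ _ _)

/-- Partitions have no common refinement in general, since their points need not be comparable; the
overlaps of their intervals take its place. -/
theorem lowerSum_le_upperSum (hf : LocallyBandPreservingOn f (Icc a b))
    (hbelow : BddBelow (f '' Icc a b)) (habove : BddAbove (f '' Icc a b))
    (P Q : IntervalPartition a b) : lowerSum f P ≤ upperSum f Q := by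
  have hP : ∀ i ∈ Finset.range P.n, P.x (i + 1) - P.x i =
      ∑ j ∈ Finset.range Q.n, overlap (P.x i) (P.x (i + 1)) (Q.x j) (Q.x (j + 1)) := fun i hi => by
    have hi := Finset.mem_range.1 hi
    exact (Q.sum_overlap (P.mem_Icc hi.le).1 (P.le_succ i hi) (P.mem_Icc hi).2).symm
  have hQ : ∀ j ∈ Finset.range Q.n, Q.x (j + 1) - Q.x j =
      ∑ i ∈ Finset.range P.n, overlap (P.x i) (P.x (i + 1)) (Q.x j) (Q.x (j + 1)) := fun j hj => by
    have hj := Finset.mem_range.1 hj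
    rw [← P.sum_overlap (Q.mem_Icc hj.le).1 (Q.le_succ j hj) (Q.mem_Icc hj).2]
    exact Finset.sum_congr rfl fun i _ => overlap_comm _ _ _ _
  rw [lowerSum, upperSum, Finset.sum_congr rfl fun i hi => by rw [hP i hi, Finset.mul_sum],
    Finset.sum_congr (s₁ := Finset.range Q.n) rfl fun j hj => by rw [hQ j hj, Finset.mul_sum],
    Finset.sum_comm]
  refine Finset.sum_le_sum fun j hj => Finset.sum_le_sum fun i hi => ?_
  have hi := Finset.mem_range.1 hi
  have hj := Finset.mem_range.1 hj
  exact sInf_mul_overlap_le_sSup_mul_overlap hf hbelow habove (P.le_succ i hi) (Q.le_succ j hj)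
    (P.Icc_subset hi) (Q.Icc_subset hj)

theorem upperSum_clamp_le (hf : LocallyBandPreservingOn f (Icc a b))
    (habove : BddAbove (f '' Icc a b)) (P : IntervalPartition a b) {u v : E} (hau : a ≤ u)
    (huv : u ≤ v) (hvb : v ≤ b) :
    upperSum f (P.clamp hau huv hvb) ≤ ∑ i ∈ Finset.range P.n,
      sSup (f '' Icc (P.x i) (P.x (i + 1))) * overlap (P.x i) (P.x (i + 1)) u v := by
  refine Finset.sum_le_sum fun i hi => ?_
  have hi := Finset.mem_range.1 hi
  rw [P.clamp_step hau huv hvb hi]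
  have hsub := (P.clamp hau huv hvb).Icc_subset (i := i) hi
  have hab := Icc_subset_Icc hau hvb
  have hst := P.le_succ i hi
  refine csSup_mul_le ((nonempty_Icc.2 ((P.clamp hau huv hvb).le_succ i hi)).image f)
    (habove.mono (image_mono (hsub.trans hab))) (overlap_nonneg _ _ _ _) ?_
  rintro _ ⟨z, hz, rfl⟩
  have hw : (z ⊔ P.x i) ⊓ P.x (i + 1) ∈ Icc (P.x i) (P.x (i + 1)) :=
    ⟨le_inf le_sup_right hst, inf_le_right⟩
  rw [hf.mul_eq (hab (hsub hz)) (P.Icc_subset hi hw) (sub_clamp_disjoint hst hz)]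
  exact mul_le_mul_of_nonneg_right
    (le_csSup (habove.mono (image_mono (P.Icc_subset hi))) ⟨_, hw, rfl⟩) (overlap_nonneg _ _ _ _)

theorem le_lowerSum_clamp (hf : LocallyBandPreservingOn f (Icc a b))
    (hbelow : BddBelow (f '' Icc a b)) (P : IntervalPartition a b) {u v : E} (hau : a ≤ u)
    (huv : u ≤ v) (hvb : v ≤ b) :
    ∑ i ∈ Finset.range P.n, sInf (f '' Icc (P.x i) (P.x (i + 1))) *
      overlap (P.x i) (P.x (i + 1)) u v ≤ lowerSum f (P.clamp hau huv hvb) := by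
  refine Finset.sum_le_sum fun i hi => ?_
  have hi := Finset.mem_range.1 hi
  rw [P.clamp_step hau huv hvb hi]
  have hsub := (P.clamp hau huv hvb).Icc_subset (i := i) hi
  have hab := Icc_subset_Icc hau hvb
  have hst := P.le_succ i hi
  refine le_csInf_mul ((nonempty_Icc.2 ((P.clamp hau huv hvb).le_succ i hi)).image f)
    (hbelow.mono (image_mono (hsub.trans hab))) (overlap_nonneg _ _ _ _) ?_
  rintro _ ⟨z, hz, rfl⟩
  have hw : (z ⊔ P.x i) ⊓ P.x (i + 1) ∈ Icc (P.x i) (P.x (i + 1)) :=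
    ⟨le_inf le_sup_right hst, inf_le_right⟩
  rw [hf.mul_eq (hab (hsub hz)) (P.Icc_subset hi hw) (sub_clamp_disjoint hst hz)]
  exact mul_le_mul_of_nonneg_right
    (csInf_le (hbelow.mono (image_mono (P.Icc_subset hi))) ⟨_, hw, rfl⟩) (overlap_nonneg _ _ _ _)

/-- Passing to a subinterval does not increase the difference of an upper and a lower sum, because
the parts of the difference over `[a, p]` and `[q, b]` are nonnegative. -/
theorem upperSum_clamp_sub_lowerSum_clamp_le (hf : LocallyBandPreservingOn f (Icc a b))
    (hbelow : BddBelow (f '' Icc a b)) (habove : BddAbove (f '' Icc a b))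
    (P Q : IntervalPartition a b) {p q : E} (hap : a ≤ p) (hpq : p ≤ q) (hqb : q ≤ b) :
    upperSum f (P.clamp hap hpq hqb) - lowerSum f (Q.clamp hap hpq hqb) ≤
      upperSum f P - lowerSum f Q := by
  have hrest : ∀ {u v : E} (hau : a ≤ u) (huv : u ≤ v) (hvb : v ≤ b),
      lowerSum f (Q.clamp hau huv hvb) ≤ upperSum f (P.clamp hau huv hvb) :=
    fun {u v} hau huv hvb => by
      have hsub : Icc u v ⊆ Icc a b := Icc_subset_Icc hau hvb
      exact lowerSum_le_upperSum (fun B hB x hx y hy => hf B hB x (hsub hx) y (hsub hy))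
        (hbelow.mono (image_mono hsub)) (habove.mono (image_mono hsub)) _ _
  have hU : upperSum f P = _ := sum_mul_step_eq P hap hpq hqb _
  have hL : lowerSum f Q = _ := sum_mul_step_eq Q hap hpq hqb _
  have hpb := hpq.trans hqb
  have haq := hap.trans hpq
  rw [hU, hL, sub_le_sub_iff]
  have h1 := (le_lowerSum_clamp hf hbelow Q le_rfl hap hpb).trans
    ((hrest le_rfl hap hpb).trans (upperSum_clamp_le hf habove P le_rfl hap hpb))
  have h2 := (le_lowerSum_clamp hf hbelow Q haq hqb le_rfl).trans
    ((hrest haq hqb le_rfl).trans (upperSum_clamp_le hf habove P haq hqb le_rfl))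
  have h3 := le_lowerSum_clamp hf hbelow Q hap hpq hqb
  have h4 := upperSum_clamp_le hf habove P hap hpq hqb
  refine (add_le_add h4 (add_le_add (add_le_add h1 h3) h2)).trans_eq ?_
  ring

theorem isGLB_upperIntegral (hab : a ≤ b) (hf : LocallyBandPreservingOn f (Icc a b))
    (hbelow : BddBelow (f '' Icc a b)) (habove : BddAbove (f '' Icc a b)) :
    IsGLB (range fun P : IntervalPartition a b => upperSum f P) (upperIntegral f a b) :=
  isGLB_csInf ⟨_, IntervalPartition.trivial hab, rfl⟩
    ⟨lowerSum f (IntervalPartition.trivial hab), by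
    rintro _ ⟨P, rfl⟩; exact lowerSum_le_upperSum hf hbelow habove _ _⟩

theorem isLUB_lowerIntegral (hab : a ≤ b) (hf : LocallyBandPreservingOn f (Icc a b))
    (hbelow : BddBelow (f '' Icc a b)) (habove : BddAbove (f '' Icc a b)) :
    IsLUB (range fun P : IntervalPartition a b => lowerSum f P) (lowerIntegral f a b) :=
  isLUB_csSup ⟨_, IntervalPartition.trivial hab, rfl⟩
    ⟨upperSum f (IntervalPartition.trivial hab), by
    rintro _ ⟨P, rfl⟩; exact lowerSum_le_upperSum hf hbelow habove _ _⟩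

theorem DarbouxIntegrableOn.restrict (hf : LocallyBandPreservingOn f (Icc a b))
    (hint : DarbouxIntegrableOn f a b) {p q : E} (hap : a ≤ p) (hpq : p ≤ q) (hqb : q ≤ b) :
    DarbouxIntegrableOn f p q := by
  obtain ⟨⟨hbelow, habove⟩, heq⟩ := hint
  have hab : a ≤ b := hap.trans (hpq.trans hqb)
  have hsub : Icc p q ⊆ Icc a b := Icc_subset_Icc hap hqb
  have hb' := hbelow.mono (image_mono hsub)
  have ha' := habove.mono (image_mono hsub)
  have hU := isGLB_upperIntegral hab hf hbelow habove
  have hL := isLUB_lowerIntegral hab hf hbelow habove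
  have hU' := isGLB_upperIntegral hpq (hf.mono hsub) hb' ha'
  have hL' := isLUB_lowerIntegral hpq (hf.mono hsub) hb' ha'
  refine ⟨⟨hb', ha'⟩, le_antisymm (sub_nonpos.1 ?_) (hL'.2 ?_)⟩
  · have h1 : ∀ P Q : IntervalPartition a b,
        upperIntegral f p q - lowerIntegral f p q ≤ upperSum f P - lowerSum f Q := fun P Q =>
      (sub_le_sub (hU'.1 ⟨P.clamp hap hpq hqb, rfl⟩) (hL'.1 ⟨Q.clamp hap hpq hqb, rfl⟩)).trans
        (upperSum_clamp_sub_lowerSum_clamp_le hf hbelow habove P Q hap hpq hqb)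
    have h2 : lowerIntegral f a b ≤
        upperIntegral f a b - (upperIntegral f p q - lowerIntegral f p q) := hL.2 (by
      rintro _ ⟨Q, rfl⟩
      rw [le_sub_iff_add_le]
      refine hU.2 ?_
      rintro _ ⟨P, rfl⟩
      exact le_sub_iff_add_le'.1 (h1 P Q))
    rw [heq] at h2
    simpa using h2
  · rintro _ ⟨Q, rfl⟩
    refine hU'.2 ?_
    rintro _ ⟨P, rfl⟩
    exact lowerSum_le_upperSum (hf.mono hsub) hb' ha' _ _

theorem DarbouxIntegrableOn.darbouxIntegral_mem_Icc (hf : LocallyBandPreservingOn f (Icc a b))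
    (hint : DarbouxIntegrableOn f a b) (hab : a ≤ b) :
    darbouxIntegral f a b ∈
      Icc (sInf (f '' Icc a b) * (b - a)) (sSup (f '' Icc a b) * (b - a)) := by
  obtain ⟨⟨hbelow, habove⟩, heq⟩ := hint
  constructor
  · have := (isLUB_lowerIntegral hab hf hbelow habove).1 ⟨IntervalPartition.trivial hab, rfl⟩
    rw [← heq] at this
    simpa [lowerSum, IntervalPartition.trivial, darbouxIntegral] using this
  · have := (isGLB_upperIntegral hab hf hbelow habove).1 ⟨IntervalPartition.trivial hab, rfl⟩
    simpa [upperSum, IntervalPartition.trivial, darbouxIntegral] using this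

/-! ### The mean value theorem -/

/-- The mean value theorem on an interval with comparable end points: the zero of
`f z * (b - a) - ∫ f` is provided by the intermediate value theorem. -/
theorem exists_mul_eq_darbouxIntegral (hf : LocallyBandPreservingOn f (Icc a b))
    (hcont : OrderContinuousOn f (Icc a b)) (hint : DarbouxIntegrableOn f a b) (hab : a ≤ b) :
    ∃ c ∈ Icc a b, f c * (b - a) = darbouxIntegral f a b := by
  have hd : 0 ≤ b - a := sub_nonneg.2 hab
  obtain ⟨hI1, hI2⟩ := hint.darbouxIntegral_mem_Icc hf hab
  obtain ⟨hbelow, habove⟩ := hint.1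
  have hne : (f '' Icc a b).Nonempty := ⟨_, a, ⟨le_rfl, hab⟩, rfl⟩
  set I := darbouxIntegral f a b
  obtain ⟨c, hc, h⟩ := exists_eq_zero_of_straddles (F := fun z => f z * (b - a) - I) hab
    (by
      intro B hB x hx y hy h
      have := hf B hB x hx y hy h
      rw [bandProj_eq_mul hB (f x), bandProj_eq_mul hB (f y)] at this
      rw [bandProj_eq_mul hB (f x * (b - a) - I), bandProj_eq_mul hB (f y * (b - a) - I)]
      linear_combination (b - a) * this)
    (by
      obtain ⟨m, hm⟩ := hbelow
      refine ⟨m * (b - a) - I, ?_⟩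
      rintro _ ⟨z, hz, rfl⟩
      exact sub_le_sub_right (mul_le_mul_of_nonneg_right (hm ⟨z, hz, rfl⟩) hd) _)
    (by
      obtain ⟨M, hM⟩ := habove
      refine ⟨M * (b - a) - I, ?_⟩
      rintro _ ⟨z, hz, rfl⟩
      exact sub_le_sub_right (mul_le_mul_of_nonneg_right (hM ⟨z, hz, rfl⟩) hd) _)
    ⟨fun t ht => by
      have := hI2.trans (csSup_mul_le hne habove hd (t := t + I) (by
        rintro _ ⟨z, hz, rfl⟩
        exact sub_le_iff_le_add.1 (ht z hz)))
      simpa using this,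
    fun t ht => by
      have := (le_csInf_mul hne hbelow hd (t := t + I) (by
        rintro _ ⟨z, hz, rfl⟩
        exact le_sub_iff_add_le.1 (ht z hz))).trans hI1
      simpa using this⟩
    (fun c hc w hw => by
      obtain ⟨S, hS, hmod⟩ := hcont.exists_modulus hc hd
      refine nonpos_of_forall_le_mul hS hd fun ε hε => ?_
      obtain ⟨n, hn⟩ := hmod ε hε
      refine hw n _ fun z hz hzc => ?_
      have h1 := abs_le'.1 (hn z hz hzc)
      rw [sub_sub_sub_cancel_right, ← sub_mul]
      refine abs_le'.2 ⟨mul_le_mul_of_nonneg_right h1.1 hd, ?_⟩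
      rw [← neg_mul]
      exact mul_le_mul_of_nonneg_right h1.2 hd)
  exact ⟨c, hc, sub_eq_zero.1 h⟩

/-- The projection onto `bandLT x y` takes the modulus of `y - x` to its positive part. -/
theorem bandProj_bandLT_mul_abs (x y : E) : bandProj (bandLT x y) 1 * |y - x| = (y - x)⁺ := by
  obtain ⟨⟨hB, -, hBpos, -⟩, hmax⟩ := isGreatest_bandLT x y
  set z := y - x
  have hz := posPart_sub_negPart z
  have habs : |z⁺| = z⁺ := abs_of_nonneg (posPart_nonneg z)
  -- the band generated by `z⁺` qualifies, hence lies in `bandLT x y`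
  have hC := isBand_disjointCompl (disjointCompl {z⁺} : Set E)
  have hzC : z⁺ ∈ disjointCompl (disjointCompl {z⁺} : Set E) := fun v hv => by
    rw [inf_comm]; exact hv _ rfl
  have hneg : z⁻ ∈ disjointCompl {z⁺} := by
    rintro v rfl
    rw [abs_of_nonneg (negPart_nonneg z), habs, inf_comm]
    exact posPart_inf_negPart_eq_zero z
  have hproj : bandProj (disjointCompl (disjointCompl {z⁺} : Set E)) z = z⁺ := by
    have h1 := bandProj_one_mul_of_mem hC hzC
    have h2 := mul_eq_zero_of_disjoint (bandProj_mem hC 1 _ hneg)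
    rw [bandProj_eq_mul hC]
    linear_combination h1 - h2 - bandProj (disjointCompl (disjointCompl {z⁺} : Set E)) 1 * hz
  have hzB : z⁺ ∈ bandLT x y := by
    refine hmax ⟨hC, ?_⟩ hzC
    rw [hproj]
    refine ⟨hzC, posPart_nonneg z, fun w hw hwz => ?_⟩
    have := hw w (by rintro _ rfl; rwa [habs])
    rw [inf_idem] at this
    exact le_antisymm ((le_abs_self w).trans this.le)
      (neg_nonpos.1 ((neg_le_abs w).trans this.le))
  have h1 := bandProj_one_mul_of_mem hB hzB
  rw [bandProj_eq_mul hB] at hBpos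
  have h2 : bandProj (bandLT x y) 1 * z⁻ = 0 := by
    refine le_antisymm ?_ (mul_nonneg (bandProj_one_nonneg _) (negPart_nonneg _))
    rw [← posPart_inf_negPart_eq_zero z]
    refine le_inf ?_ (mul_le_of_le_one_left (negPart_nonneg _) (bandProj_one_le _))
    have : bandProj (bandLT x y) 1 * z = z⁺ - bandProj (bandLT x y) 1 * z⁻ := by
      linear_combination h1 - bandProj (bandLT x y) 1 * hz
    rwa [this, sub_nonneg] at hBpos
  rw [← posPart_add_negPart, mul_add, h1, h2, add_zero]

theorem mean_value (hf : LocallyBandPreservingOn f (Icc a b))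
    (hcont : OrderContinuousOn f (Icc a b)) (hint : DarbouxIntegrableOn f a b) {x y : E}
    (hx : x ∈ Icc a b) (hy : y ∈ Icc a b) :
    DarbouxIntegrableOn f (x ⊓ y) (x ⊔ y) ∧
      ∃ c ∈ Icc (x ⊓ y) (x ⊔ y), (y - x) * f c = integralFromTo f x y := by
  have hap : a ≤ x ⊓ y := le_inf hx.1 hy.1
  have hqb : x ⊔ y ≤ b := sup_le hx.2 hy.2
  have hpq : x ⊓ y ≤ x ⊔ y := inf_le_left.trans le_sup_left
  have hsub : Icc (x ⊓ y) (x ⊔ y) ⊆ Icc a b := Icc_subset_Icc hap hqb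
  have hint' := hint.restrict hf hap hpq hqb
  refine ⟨hint', ?_⟩
  obtain ⟨c, hc, h⟩ := exists_mul_eq_darbouxIntegral (hf.mono hsub)
    (fun c hc ι _ _ _ z hz => hcont c (hsub hc) ι z fun i => hsub (hz i)) hint' hpq
  refine ⟨c, hc, ?_⟩
  rw [sup_sub_inf_eq_abs_sub] at h
  have h1 := bandProj_bandLT_mul_abs x y
  have h2 := bandProj_bandLT_mul_abs y x
  rw [abs_sub_comm, ← neg_sub y x, posPart_neg] at h2
  have h3 := posPart_sub_negPart (y - x)
  rw [integralFromTo, bandProj_eq_mul (isGreatest_bandLT x y).1.1,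
    bandProj_eq_mul (isGreatest_bandLT y x).1.1, ← h]
  linear_combination f c * (h2 - h1 - h3)

end Sums

end VL

theorem theoremt {E : Type*} [Ring E] [Algebra ℝ E] [ConditionallyCompleteLattice E]
    [IsOrderedAddMonoid E] [PosSMulMono ℝ E] [VL.IsFAlgebra E]
    (a b : E) (hab : a ≤ b) (f : E → E)
    (hlbp : VL.LocallyBandPreservingOn f (Set.Icc a b))
    (hcont : VL.OrderContinuousOn f (Set.Icc a b))
    (hint : VL.DarbouxIntegrableOn f a b) :
    ∀ x ∈ Set.Icc a b, ∀ y ∈ Set.Icc a b,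
      VL.DarbouxIntegrableOn f (x ⊓ y) (x ⊔ y) ∧
        ∃ c ∈ Set.Icc (x ⊓ y) (x ⊔ y), (y - x) * f c = VL.integralFromTo f x y := by
  intro x hx y hy
  -- commutativity is a theorem, so that the results on commutative `E` apply to the given ring
  let R : CommRing E := { ‹Ring E› with mul_comm := VL.mul_comm_of_isFAlgebra }
  exact VL.mean_value (E := E) hlbp hcont hint hx hy
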